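/- Let $H$ be an infinite-dimensional separable complex Hilbert space with an orthonormal basis $(e_n)_{n\in\mathbb N}$, let $\mathcal K(H)\subseteq\mathcal B(H)$ be the compact and the bounded operators, and let $\pi\colon\mathcal B(H)\to\mathcal C(H)=\mathcal B(H)/\mathcal K(H)$ be the quotient map onto the Calkin algebra. For a partition $\vec E=(E_n)_{n\in\mathbb N}$ of $\mathbb N$ into consecutive nonempty finite intervals let $\mathcal D[\vec E]$ be the set of all $a\in\mathcal B(H)$ such that $\mathrm{span}\{e_i: i\in E_n\}$ is invariant under $a$ for every $n$. For $u\in\mathcal B(H)$ write $\Psi_u(a)=uau^*$. A *coherent family of unitaries* is a set $\mathcal F$ of pairs $(\vec E,u)$ such that (1) for each $(\vec E,u)\in\mathcal F$, $\vec E$ is a partition as above and $u$ is a partial isometry between closed subspaces of $H$ of finite codimension; (2) for all $(\vec E,u),(\vec F,v)\in\mathcal F$ and all $a\in\mathcal D[\vec E]\cap\mathcal D[\vec F]$ the operator $\Psi_u(a)-\Psi_v(a)$ is compact; (3) for every partition $\vec E$ as above there is $u$ with $(\vec E,u)\in\mathcal F$. A $*$-automorphism $\Phi$ of $\mathcal C(H)$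 is *determined by* $\mathcal F$ if $\Phi(\pi(a))=\pi(\Psi_u(a))$ for all $(\vec E,u)\in\mathcal F$ and all $a\in\mathcal D[\vec E]$. It is *inner* if there is a unitary $v\in\mathcal C(H)$ with $\Phi(x)=vxv^*$ for all $x\in\mathcal C(H)$. Todorcevic's Axiom (TA) is the following assertion: if $X$ is a separable metric space, $[X]^2$ is the set of its two-element subsets, and $[X]^2=K_0\cup K_1$ is a partition such that $K_0$, viewed as a symmetric subset of $X\times X$ minus the diagonal, is open, then either there is an uncountable $Y\subseteq X$ with $[Y]^2\subseteq K_0$, or $X=\bigcup_{n\in\mathbb N}Y_n$ for some sets $Y_n$ with $[Y_n]^2\subseteq K_1$ for all $n$. **Theorem.** Assume TA. Then: (a) every $*$-automorphism of $\mathcal C(H)$ determined by a coherent family of unitaries is inner; (b) for every coherent family of unitaries $\mathcal F$ there is a single partial isometry $w$ between closed subspaces of $H$ of finite codimension such that $\Psi_u(a)-\Psi_w(a)$ is compact for all $(\vec E,u)\in\mathcal F$ and all $a\in\mathcal D[\vec E]$. -/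

import Mathlib

/-! ### Todorcevic's Axiom -/

/-- Todorcevic's Axiom (the Open Coloring Axiom). A coloring `[X]² = K₀ ∪ K₁` is given by the set
`K₀`, viewed as a symmetric subset of `X × X` minus the diagonal; it is open if this subset is open.
The set `K₁` consists of the remaining pairs of distinct points. -/
def TodorcevicAxiom : Prop :=
  ∀ (X : Type) [MetricSpace X] [TopologicalSpace.SeparableSpace X] (K₀ : Set (X × X)),
    IsOpen K₀ → (∀ x y, (x, y) ∈ K₀ → (y, x) ∈ K₀) → (∀ x, (x, x) ∉ K₀) →
      (∃ Y : Set X, ¬ Y.Countable ∧ ∀ x ∈ Y, ∀ y ∈ Y, x ≠ y → (x, y) ∈ K₀) ∨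
      (∃ Y : ℕ → Set X, (⋃ n, Y n) = Set.univ ∧
        ∀ n, ∀ x ∈ Y n, ∀ y ∈ Y n, x ≠ y → (x, y) ∉ K₀)

/-! ### The Calkin algebra -/

section Calkin

variable (H : Type*) [NormedAddCommGroup H] [InnerProductSpace ℂ H]

/-- The ideal of compact operators in the algebra of bounded operators. -/
def compactIdeal : Ideal (H →L[ℂ] H) where
  carrier := {a | IsCompactOperator a}
  add_mem' := fun ha hb => IsCompactOperator.add ha hb
  zero_mem' := isCompactOperator_zero
  smul_mem' := fun c _ ha => IsCompactOperator.clm_comp ha c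

theorem mem_compactIdeal {H : Type*} [NormedAddCommGroup H] [InnerProductSpace ℂ H]
    {a : H →L[ℂ] H} : a ∈ compactIdeal H ↔ IsCompactOperator a := Iff.rfl

instance compactIdeal_isTwoSided : (compactIdeal H).IsTwoSided :=
  ⟨fun {_} b ha => IsCompactOperator.comp_clm ha b⟩

/-- The Calkin algebra of `H`. -/
abbrev Calkin : Type _ := (H →L[ℂ] H) ⧸ compactIdeal H

/-- The quotient map from the bounded operators onto the Calkin algebra. -/
abbrev calkinMk : (H →L[ℂ] H) →+* Calkin H := Ideal.Quotient.mk (compactIdeal H)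

variable [CompleteSpace H]

/-- The adjoint of a compact operator is compact. -/
theorem isCompactOperator_star {H : Type*} [NormedAddCommGroup H] [InnerProductSpace ℂ H]
    [CompleteSpace H] {a : H →L[ℂ] H} (ha : IsCompactOperator a) :
    IsCompactOperator (star a : H →L[ℂ] H) := by
  have h1 : IsCompactOperator (a * star a : H →L[ℂ] H) := ha.comp_clm (star a)
  have h2 : TotallyBounded ((a * star a : H →L[ℂ] H) '' Metric.closedBall 0 1) :=
    (h1.isCompact_closure_image_closedBall (𝕜₁ := ℂ) (f := (a * star a : H →L[ℂ] H).toLinearMap)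
      1).totallyBounded.subset subset_closure
  have key : ∀ z : H, ‖(star a) z‖ ^ 2 ≤ ‖(a * star a) z‖ * ‖z‖ := by
    intro z
    have h : inner ℂ ((star a) z) ((star a) z) = inner ℂ z ((a * star a) z) := by
      rw [ContinuousLinearMap.star_eq_adjoint, ContinuousLinearMap.adjoint_inner_left]
      rfl
    have h' : ‖inner ℂ ((star a) z) ((star a) z)‖ = ‖(star a) z‖ ^ 2 := by
      rw [inner_self_eq_norm_sq_to_K]; simp
    rw [← h', h, mul_comm]
    exact norm_inner_le_norm _ _
  have h3 : TotallyBounded ((star a : H →L[ℂ] H) '' Metric.closedBall 0 1) := by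
    rw [Metric.totallyBounded_iff]
    intro ε hε
    obtain ⟨t, hts, htf, ht⟩ := Metric.finite_approx_of_totallyBounded h2 (ε ^ 2 / 2) (by positivity)
    obtain ⟨t', ht's, ht'f, rfl⟩ := Set.exists_subset_image_finite_and.1 ⟨t, hts, htf, rfl⟩
    refine ⟨(star a : H →L[ℂ] H) '' t', ht'f.image _, ?_⟩
    rintro _ ⟨x, hx, rfl⟩
    have := ht ⟨x, hx, rfl⟩
    simp only [Set.mem_iUnion, Set.mem_image, exists_prop, exists_exists_and_eq_and] at this ⊢
    obtain ⟨y, hy, hxy⟩ := this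
    refine ⟨y, hy, ?_⟩
    have hyB := ht's hy
    rw [Metric.mem_ball, dist_eq_norm, ← map_sub] at hxy ⊢
    have hn : ‖x - y‖ ≤ 2 := by
      have h4 := norm_sub_le x y
      rw [mem_closedBall_zero_iff] at hx hyB
      linarith
    have h5 := key (x - y)
    have h6 := norm_nonneg ((a * star a) (x - y))
    exact lt_of_pow_lt_pow_left₀ 2 hε.le (by nlinarith)
  rw [isCompactOperator_iff_exists_mem_nhds_isCompact_closure_image]
  exact ⟨Metric.closedBall 0 1, Metric.closedBall_mem_nhds 0 one_pos,
    h3.closure.isCompact_of_isClosed isClosed_closure⟩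

/-- The involution of the Calkin algebra: `π(a)* = π(a*)`. -/
noncomputable instance calkinStarRing : StarRing (Calkin H) where
  star := Quotient.map' (fun a => star a) (by
    intro a b hab
    rw [Submodule.quotientRel_def] at hab ⊢
    rw [← star_sub]
    exact isCompactOperator_star hab)
  star_involutive := by
    intro x
    obtain ⟨a, rfl⟩ := Ideal.Quotient.mk_surjective x
    exact congrArg (calkinMk H) (star_star a)
  star_mul := by
    intro x y
    obtain ⟨a, rfl⟩ := Ideal.Quotient.mk_surjective x
    obtain ⟨b, rfl⟩ := Ideal.Quotient.mk_surjective y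
    exact congrArg (calkinMk H) (star_mul a b)
  star_add := by
    intro x y
    obtain ⟨a, rfl⟩ := Ideal.Quotient.mk_surjective x
    obtain ⟨b, rfl⟩ := Ideal.Quotient.mk_surjective y
    exact congrArg (calkinMk H) (star_add a b)

theorem calkinMk_star {H : Type*} [NormedAddCommGroup H] [InnerProductSpace ℂ H]
    [CompleteSpace H] (a : H →L[ℂ] H) : calkinMk H (star a) = star (calkinMk H a) := rfl

instance calkinStarModule : StarModule ℂ (Calkin H) where
  star_smul := by
    intro c x
    obtain ⟨a, rfl⟩ := Ideal.Quotient.mk_surjective x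
    exact congrArg (calkinMk H) (star_smul c a)

variable {H}

/-- A `*`-automorphism of the Calkin algebra is inner if it is conjugation by a unitary of the
Calkin algebra. -/
def IsInnerAut (Φ : Calkin H ≃⋆ₐ[ℂ] Calkin H) : Prop :=
  ∃ v ∈ unitary (Calkin H), ∀ x, Φ x = v * x * star v

end Calkin

/-! ### Coherent families of unitaries -/

/-- A partition of `ℕ` into consecutive nonempty finite intervals, given by the left endpoints of
the intervals. -/
structure IntervalPartition where
  /-- The left endpoint of the `n`-th interval. -/
  start : ℕ → ℕ
  start_zero : start 0 = 0
  strictMono : StrictMono start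

/-- The `n`-th interval of the partition. -/
def IntervalPartition.block (E : IntervalPartition) (n : ℕ) : Set ℕ :=
  Set.Ico (E.start n) (E.start (n + 1))

section Coherent

variable {H : Type*} [NormedAddCommGroup H] [InnerProductSpace ℂ H]

/-- `D[E]`: all bounded operators leaving invariant the span of `{e i | i ∈ E n}` for every `n`. -/
def fddAlgebra (e : HilbertBasis ℕ ℂ H) (E : IntervalPartition) : Set (H →L[ℂ] H) :=
  {a | ∀ n, ∀ x ∈ Submodule.span ℂ ((fun i => e i) '' E.block n),
    a x ∈ Submodule.span ℂ ((fun i => e i) '' E.block n)}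

variable [CompleteSpace H]

/-- `u` is a partial isometry whose initial space `(ker u)ᗮ` and final space `(ker u*)ᗮ` have
finite codimension. -/
def IsCofinitePartialIsometry (u : H →L[ℂ] H) : Prop :=
  u * star u * u = u ∧ FiniteDimensional ℂ (LinearMap.ker u.toLinearMap) ∧
    FiniteDimensional ℂ (LinearMap.ker (star u : H →L[ℂ] H).toLinearMap)

/-- Conjugation `a ↦ u a u*`. -/
noncomputable def conjBy (u a : H →L[ℂ] H) : H →L[ℂ] H := u * a * star u

/-- A coherent family of unitaries (with respect to the orthonormal basis `e`). -/
structure IsCoherentFamily (e : HilbertBasis ℕ ℂ H)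
    (F : Set (IntervalPartition × (H →L[ℂ] H))) : Prop where
  partialIsometry : ∀ p ∈ F, IsCofinitePartialIsometry p.2
  coherent : ∀ p ∈ F, ∀ q ∈ F, ∀ a ∈ fddAlgebra e p.1 ∩ fddAlgebra e q.1,
    IsCompactOperator (conjBy p.2 a - conjBy q.2 a)
  total : ∀ E : IntervalPartition, ∃ u, (E, u) ∈ F

/-- `Φ` is determined by the coherent family `F`: for every `(E, u)` in `F`, conjugation by `u` is
a representation of `Φ` on `D[E]`. -/
def IsDeterminedBy (e : HilbertBasis ℕ ℂ H) (Φ : Calkin H ≃⋆ₐ[ℂ] Calkin H)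
    (F : Set (IntervalPartition × (H →L[ℂ] H))) : Prop :=
  IsCoherentFamily e F ∧
    ∀ p ∈ F, ∀ a ∈ fddAlgebra e p.1, Φ (calkinMk H a) = calkinMk H (conjBy p.2 a)

end Coherent

open Filter Topology Set Cardinal

/-! Modulo compact operators a coherent family of unitaries is a coherent family of phase sequences.
Every `D[E]` contains the diagonal operators. So for a fixed member `u₀` and any member `u`, the
operator `star u₀ * u` commutes modulo compacts with all coordinate projections, and is therefore a
compact perturbation of a diagonal operator (`exists_diagOp_sub_compact`). Hence `u` equals `u₀`
times a diagonal unitary with entries `α : ℕ → Circle`, modulo compacts (`exists_eq_mul_phaseOp`).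
Coherence forces `α i / α j` and `β i / β j` to be asymptotically equal for `i`, `j` in common
blocks (`phaseClose_of_calkinMk_conjBy_eq`); conversely, asymptotically equal phases on the blocks
of `E` act equally on `D[E]` (`calkinMk_conjBy_phaseOp_eq`). Thus (b) amounts to finding one
sequence that matches all the phases.

TA enters there. Phases over two interlaced coarsenings of a fast growing partition are amalgamated
into a sequence `A f` that controls all pairs `i ≤ j ≤ f i` (`exists_amalgam`). For fixed `ε`,
colour `{f, f'}` by whether `A f` and `A f'` differ by more than `ε` at some common pair. There is
no uncountable homogeneous set: by a first use of TA every uncountable family of functions has an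
uncountable subfamily bounded modulo finite sets (`TodorcevicAxiom.exists_bounded`), and comparison
with a bound leaves only finitely many coordinates, settled by separability. So countably many
pieces without large differences cover everything; one of them is cofinal and yields a sequence that
works up to `3 * ε` (`exists_approx_uniform`). The sequences for `ε = 2⁻ⁿ` are glued
(`exists_glued`).

For (a), conjugation by the resulting `w` represents the automorphism on every `D[E]`. Each operator
is block tridiagonal modulo compacts, so the algebras `D[E]` and the compacts generate all operators
additively (`closure_fddAlgebra_union_compact`). -/

/-! ### Domination modulo finite sets and the first use of TA. -/

theorem exists_not_countable_fiber {α β : Type*} [Countable β] {S : Set α} (hS : ¬ S.Countable)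
    (φ : α → β) : ∃ b, ¬ {x ∈ S | φ x = b}.Countable := by
  by_contra! h
  refine hS ((countable_iUnion h).mono fun x hx => ?_)
  exact mem_iUnion.2 ⟨φ x, hx, rfl⟩

/-- Countable sets of functions `ℕ → ℕ` are bounded modulo finite sets. -/
theorem exists_monotone_eventually_ge {C : Set (ℕ → ℕ)} (hC : C.Countable) :
    ∃ g : ℕ → ℕ, Monotone g ∧ ∀ c ∈ C, ∀ᶠ n in atTop, c n ≤ g n := by
  obtain rfl | hne := C.eq_empty_or_nonempty
  · exact ⟨id, monotone_id, by simp⟩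
  obtain ⟨c, rfl⟩ := hC.exists_eq_range hne
  refine ⟨fun n => ∑ k ∈ Finset.range (n + 1), ∑ j ∈ Finset.range (n + 1), c k j, ?_, ?_⟩
  · intro m n hmn
    have h : Finset.range (m + 1) ⊆ Finset.range (n + 1) := Finset.range_mono (by omega)
    exact (Finset.sum_le_sum fun k _ => Finset.sum_le_sum_of_subset h).trans
      (Finset.sum_le_sum_of_subset h)
  · rintro _ ⟨k, rfl⟩
    filter_upwards [eventually_ge_atTop k] with n hn
    calc c k n ≤ ∑ j ∈ Finset.range (n + 1), c k j :=
          Finset.single_le_sum (f := fun j => c k j) (fun _ _ => Nat.zero_le _) (by simp)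
      _ ≤ _ := Finset.single_le_sum (f := fun k => ∑ j ∈ Finset.range (n + 1), c k j)
          (fun _ _ => Nat.zero_le _) (by simpa using by omega)

theorem countable_Iio_of_aleph_one (ξ : (ℵ₁ : Cardinal.{0}).ord.ToType) : (Iio ξ).Countable := by
  have := Cardinal.mk_Iio_lt ξ (by simp)
  rwa [Cardinal.mk_ord_toType, Cardinal.lt_aleph_one_iff,
    Cardinal.le_aleph0_iff_set_countable] at this

/-- A family of functions indexed by `ω₁`, increasing modulo finite sets and dominating a given
family. -/
theorem exists_increasing_family (y : (ℵ₁ : Cardinal.{0}).ord.ToType → ℕ → ℕ) :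
    ∃ G : (ℵ₁ : Cardinal.{0}).ord.ToType → ℕ → ℕ, (∀ ξ, Monotone (G ξ)) ∧
      (∀ ξ, ∀ᶠ n in atTop, y ξ n ≤ G ξ n) ∧
      ∀ η ξ, η < ξ → ∀ᶠ n in atTop, G η n < G ξ n := by
  have hb : ∀ C : Set (ℕ → ℕ), ∃ g : ℕ → ℕ, C.Countable →
      Monotone g ∧ ∀ c ∈ C, ∀ᶠ n in atTop, c n ≤ g n := fun C => by
    by_cases hC : C.Countable
    · obtain ⟨g, hg⟩ := exists_monotone_eventually_ge hC
      exact ⟨g, fun _ => hg⟩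
    · exact ⟨0, fun h => absurd h hC⟩
  choose b hb using hb
  let wf : WellFounded (α := (ℵ₁ : Cardinal.{0}).ord.ToType) (· < ·) := wellFounded_lt
  -- The stage `ξ` dominates `y ξ` and the countably many earlier functions; adding 1 to these makes
  -- the increase strict.
  let C : ∀ ξ, (∀ η, η < ξ → ℕ → ℕ) → Set (ℕ → ℕ) := fun ξ ih =>
    insert (y ξ) (range fun η : Iio ξ => fun n => ih η.1 η.2 n + 1)
  have hC : ∀ ξ ih, (C ξ ih).Countable := fun ξ ih => by
    have := (countable_Iio_of_aleph_one ξ).to_subtype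
    exact (countable_range _).insert _
  let G := wf.fix fun ξ ih => b (C ξ ih)
  have hG : ∀ ξ, G ξ = b (C ξ fun η _ => G η) := fun ξ => wf.fix_eq _ ξ
  refine ⟨G, fun ξ => ?_, fun ξ => ?_, fun η ξ h => ?_⟩
  · rw [hG]; exact (hb _ (hC ξ fun η _ => G η)).1
  · rw [hG]; exact (hb _ (hC ξ fun η _ => G η)).2 _ (mem_insert _ _)
  · have := (hb _ (hC ξ fun η _ => G η)).2 (fun n => G η n + 1) (mem_insert_of_mem _ ⟨⟨η, h⟩, rfl⟩)
    rw [← hG] at this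
    exact this

/-- Openness of a coloring depends only on the topology, so subspaces of countable products can be
used without a chosen metric. -/
theorem TodorcevicAxiom.of_metrizable (hTA : TodorcevicAxiom) {X : Type} [TopologicalSpace X]
    [TopologicalSpace.MetrizableSpace X] [SecondCountableTopology X] {K₀ : Set (X × X)}
    (ho : IsOpen K₀) (hs : ∀ x y, (x, y) ∈ K₀ → (y, x) ∈ K₀) (hi : ∀ x, (x, x) ∉ K₀) :
    (∃ Y : Set X, ¬ Y.Countable ∧ ∀ x ∈ Y, ∀ y ∈ Y, x ≠ y → (x, y) ∈ K₀) ∨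
      (∃ Y : ℕ → Set X, (⋃ n, Y n) = Set.univ ∧
        ∀ n, ∀ x ∈ Y n, ∀ y ∈ Y n, x ≠ y → (x, y) ∉ K₀) := by
  let := TopologicalSpace.metrizableSpaceMetric X
  exact hTA X K₀ ho hs hi

/-- A set `Y` of monotone functions contains two distinct comparable functions if some dense
subset `D` of `Y` is dominated modulo finite sets by a function `a`, which in turn is dominated
from `m` on by all members of an unbounded subset `B` of `Y`. -/
theorem exists_le_of_unbounded {Y B D : Set (ℕ → ℕ)} {a : ℕ → ℕ} {m : ℕ}
    (hmono : ∀ b ∈ Y, Monotone b) (hBY : B ⊆ Y) (hDY : D ⊆ Y) (hD : Y ⊆ closure D)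
    (hDa : ∀ d ∈ D, ∀ᶠ n in atTop, d n ≤ a n) (haB : ∀ b ∈ B, ∀ n, m ≤ n → a n ≤ b n)
    (hB : ¬ ∃ g : ℕ → ℕ, ∀ b ∈ B, ∀ n, b n ≤ g n) :
    ∃ f ∈ Y, ∃ b ∈ Y, f ≠ b ∧ f ≤ b := by
  classical
  have hex : ∃ n, ∀ k, ∃ b ∈ B, k ≤ b n := by
    by_contra! h
    choose g hg using h
    exact hB ⟨g, fun b hb n => (hg n b hb).le⟩
  -- Let `n` be the first argument at which `B` is unbounded. Below `n` only finitely many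
  -- restrictions occur, so infinitely many of the members `b k` with `b k n ≥ k` agree there.
  have hn := Nat.find_spec hex
  have hmin := fun i (hi : i < Nat.find hex) => Nat.find_min hex hi
  generalize Nat.find hex = n at hn hmin
  push Not at hmin
  choose! M hM using hmin
  choose b hbB hbn using hn
  let c : ℕ → (i : Fin n) → Fin (M i) := fun k i => ⟨b k i, hM i i.2 _ (hbB k)⟩
  obtain ⟨t, ht⟩ := Finite.exists_infinite_fiber c
  rw [Set.infinite_coe_iff] at ht
  obtain ⟨k₀, hk₀⟩ := ht.nonempty
  have hopen : IsOpen {z : ℕ → ℕ | ∀ i ∈ Finset.range n, z i = b k₀ i} := by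
    have : {z : ℕ → ℕ | ∀ i ∈ Finset.range n, z i = b k₀ i}
        = ⋂ i ∈ Finset.range n, (fun z : ℕ → ℕ => z i) ⁻¹' {b k₀ i} := by ext; simp
    rw [this]
    exact isOpen_biInter_finset fun i _ => (isOpen_discrete _).preimage (continuous_apply i)
  obtain ⟨f, hf, hfD⟩ := mem_closure_iff.1 (hD (hBY (hbB k₀))) _ hopen (by simp)
  obtain ⟨k, hk⟩ := eventually_atTop.1 (hDa f hfD)
  -- The member `b q` is chosen so tall at `n` that `f ≤ b q` everywhere: they agree below `n`,
  -- monotonicity gives the inequality up to `max k (max m n)`, and beyond that point `f ≤ a ≤ b q`.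
  obtain ⟨q, hq, hqk⟩ := ht.exists_gt (f (max k (max m n)))
  have hqt : ∀ i < n, f i = b q i := fun i hi => by
    rw [hf i (Finset.mem_range.2 hi)]
    have h := (hk₀ : c k₀ = t).trans (hq : c q = t).symm
    simpa [c] using congrFun h ⟨i, hi⟩
  have hlt : f (max k (max m n)) < b q n := hqk.trans_le (hbn q)
  refine ⟨f, hDY hfD, b q, hBY (hbB q), ?_, fun i => ?_⟩
  · rintro h
    have := hmono f (hDY hfD) (show n ≤ max k (max m n) by simp)
    rw [h] at this hlt
    omega
  · rcases lt_or_ge i n with hi | hi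
    · exact (hqt i hi).le
    rcases le_total i (max k (max m n)) with hi' | hi'
    · exact ((hmono f (hDY hfD) hi').trans hlt.le).trans (hmono _ (hBY (hbB q)) hi)
    · exact (hk i (by simp at hi'; omega)).trans (haB _ (hbB q) i (by simp at hi'; omega))

/-- Todorcevic's Axiom implies that families of `ℵ₁` functions are bounded modulo finite sets. -/
theorem TodorcevicAxiom.exists_bounded (hTA : TodorcevicAxiom) {X : Type} {S : Set X}
    (hS : ¬ S.Countable) (φ : X → ℕ → ℕ) :
    ∃ g : ℕ → ℕ, Monotone g ∧ ¬ {x ∈ S | ∀ᶠ n in atTop, φ x n ≤ g n}.Countable := by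
  by_contra! hcon
  have hcon' : ∀ g : ℕ → ℕ, {x ∈ S | ∀ᶠ n in atTop, φ x n ≤ g n}.Countable := fun g => by
    obtain ⟨g', hg', h⟩ := exists_monotone_eventually_ge (countable_singleton g)
    refine (hcon g' hg').mono ?_
    rintro x ⟨hxS, hx⟩
    refine ⟨hxS, ?_⟩
    filter_upwards [hx, h g rfl] with n h1 h2 using h1.trans h2
  have hcard : #((ℵ₁ : Cardinal.{0}).ord.ToType) ≤ #S := by
    rw [Cardinal.mk_ord_toType, Cardinal.aleph_one_le_iff, ← not_le,
      Cardinal.le_aleph0_iff_set_countable]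
    exact hS
  obtain ⟨ι⟩ := (Cardinal.le_def _ _).1 hcard
  obtain ⟨G, hGm, hGy, hGlt⟩ := exists_increasing_family fun ξ => φ (ι ξ)
  have hWc : ¬ (univ : Set (ℵ₁ : Cardinal.{0}).ord.ToType).Countable := by
    rw [← Cardinal.le_aleph0_iff_set_countable, Cardinal.mk_univ, Cardinal.mk_ord_toType, not_le]
    exact Cardinal.aleph0_lt_aleph_one
  have hI : ∀ ξ : (ℵ₁ : Cardinal.{0}).ord.ToType, (Iic ξ).Countable := fun ξ => by
    rw [← Iio_insert]
    exact (countable_Iio_of_aleph_one ξ).insert _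
  have hbdd : ∀ C : Set (ℵ₁ : Cardinal.{0}).ord.ToType, C.Countable → ∃ ξ, ∀ η ∈ C, η < ξ := by
    intro C hC
    by_contra! h
    refine hWc ((hC.biUnion fun η _ => hI η).mono fun ξ _ => ?_)
    obtain ⟨η, hη, hle⟩ := h ξ
    exact mem_biUnion hη hle
  have hunb : ∀ T : Set (ℵ₁ : Cardinal.{0}).ord.ToType, ¬ T.Countable →
      ¬ ∃ g : ℕ → ℕ, ∀ ξ ∈ T, ∀ᶠ n in atTop, G ξ n ≤ g n := by
    rintro T hT ⟨g, hg⟩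
    have : ((fun ξ => (ι ξ : X)) '' T).Countable := (hcon' g).mono (by
      rintro _ ⟨ξ, hξ, rfl⟩
      refine ⟨(ι ξ).2, ?_⟩
      filter_upwards [hGy ξ, hg ξ hξ] with n h1 h2 using h1.trans h2)
    exact hT (countable_of_injective_of_countable_image
      (Subtype.val_injective.comp ι.injective).injOn this)
  have hfib : ∀ Y : Set (range G), ¬ Y.Countable →
      ¬ {ξ | (⟨G ξ, mem_range_self ξ⟩ : range G) ∈ Y}.Countable := by
    intro Y hY hc
    refine hY ((hc.image fun ξ => (⟨G ξ, mem_range_self ξ⟩ : range G)).mono ?_)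
    rintro ⟨_, ξ, rfl⟩ h
    exact ⟨ξ, h, rfl⟩
  -- Pairs that are incomparable pointwise; two coordinates witness this, so the coloring is open.
  let K : Set (range G × range G) := {p | (∃ n, p.1.1 n < p.2.1 n) ∧ ∃ n, p.2.1 n < p.1.1 n}
  have c1 : ∀ n, Continuous fun p : range G × range G => p.1.1 n := fun n =>
    (continuous_apply n).comp (continuous_subtype_val.comp continuous_fst)
  have c2 : ∀ n, Continuous fun p : range G × range G => p.2.1 n := fun n =>
    (continuous_apply n).comp (continuous_subtype_val.comp continuous_snd)
  have hK : IsOpen K := by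
    have : K = (⋃ n, {p | p.1.1 n < p.2.1 n}) ∩ ⋃ n, {p | p.2.1 n < p.1.1 n} := by
      ext; simp [K]
    rw [this]
    exact (isOpen_iUnion fun n => isOpen_lt (c1 n) (c2 n)).inter
      (isOpen_iUnion fun n => isOpen_lt (c2 n) (c1 n))
  rcases hTA.of_metrizable hK (fun x y h => ⟨h.2, h.1⟩) (fun x h => by simp [K] at h) with
    ⟨Y, hYc, hY⟩ | ⟨Y, hYu, hY⟩
  · have hT := hfib Y hYc
    let Z : Set (ℕ → ℕ) := Subtype.val '' Y
    obtain ⟨D, hDZ, hDc, hD⟩ :=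
      (TopologicalSpace.IsSeparable.of_separableSpace Z).exists_countable_dense_subset
    have : Nonempty (ℵ₁ : Cardinal.{0}).ord.ToType := ⟨(hbdd ∅ countable_empty).choose⟩
    choose! ζ hζ using fun d (hd : d ∈ Z) => (show ∃ ξ, G ξ = d by
      obtain ⟨⟨_, ξ, rfl⟩, -, rfl⟩ := hd
      exact ⟨ξ, rfl⟩)
    -- The countably many indices of the dense set lie below one `ξ`, so `G ξ` dominates it modulo
    -- finite sets. Uncountably many later functions dominate `G ξ` from a common point `m₀` on.
    obtain ⟨ξ, hξ⟩ := hbdd _ (hDc.image ζ)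
    have hT' : ¬ {η | (⟨G η, mem_range_self η⟩ : range G) ∈ Y ∧ ξ < η}.Countable := fun hc => by
      refine hT ((hc.union (hI ξ)).mono fun η hη => ?_)
      rcases lt_or_ge ξ η with h | h
      · exact Or.inl ⟨hη, h⟩
      · exact Or.inr h
    choose! m hm using fun η (h : ξ < η) => eventually_atTop.1 (hGlt ξ η h)
    obtain ⟨m₀, hm₀⟩ := exists_not_countable_fiber hT' m
    obtain ⟨f, ⟨f', hf', rfl⟩, b, ⟨b', hb', rfl⟩, hne, hle⟩ := exists_le_of_unbounded (Y := Z)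
      (B := G '' {η | η ∈ {η | (⟨G η, mem_range_self η⟩ : range G) ∈ Y ∧ ξ < η} ∧ m η = m₀})
      (D := D) (a := G ξ) (m := m₀)
      (by rintro _ ⟨⟨_, η, rfl⟩, -, rfl⟩; exact hGm η)
      (by rintro _ ⟨η, hη, rfl⟩; exact ⟨_, hη.1.1, rfl⟩) hDZ hD
      (fun d hd => by
        have h := hGlt _ _ (hξ _ (mem_image_of_mem ζ hd))
        rw [hζ d (hDZ hd)] at h
        exact h.mono fun n hn => hn.le)
      (by
        rintro _ ⟨η, ⟨⟨-, hη⟩, rfl⟩, rfl⟩ n hn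
        exact (hm η hη n hn).le)
      (by
        rintro ⟨g, hg⟩
        exact hunb _ hm₀ ⟨g, fun η hη => Eventually.of_forall fun n => hg _ ⟨η, hη, rfl⟩ n⟩)
    obtain ⟨n, hn⟩ := (hY f' hf' b' hb' fun h => hne (congrArg _ h)).2
    exact absurd (hle n) hn.not_ge
  · obtain ⟨n, hn⟩ : ∃ n, ¬ (Y n).Countable := by
      by_contra! h
      have hc := countable_iUnion h
      rw [hYu] at hc
      obtain ⟨g, -, hg⟩ := exists_monotone_eventually_ge (hc.image (Subtype.val : range G → ℕ → ℕ))
      exact hunb univ hWc ⟨g, fun ξ _ => hg _ ⟨⟨G ξ, ξ, rfl⟩, trivial, rfl⟩⟩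
    set T := {ξ | (⟨G ξ, mem_range_self ξ⟩ : range G) ∈ Y n} with hTdef
    have hT : ¬ T.Countable := hfib _ hn
    have hmonoT : ∀ η ∈ T, ∀ ξ ∈ T, η < ξ → ∀ k, G η k ≤ G ξ k := by
      intro η hη ξ hξ hlt k
      by_contra! hk
      obtain ⟨l, hl⟩ := (hGlt η ξ hlt).exists
      refine hY n _ hη _ hξ (fun h => ?_) ⟨⟨l, hl⟩, ⟨k, hk⟩⟩
      have : G η = G ξ := congrArg Subtype.val h
      rw [this] at hk
      exact lt_irrefl _ hk
    -- On `T` the functions increase pointwise along `ω₁`. Were coordinate `k` unbounded, countably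
    -- many indices would witness it, and a member `ξ'` of `T` beyond them all would have a value at
    -- `k` exceeding itself.
    have hpt : ∀ k, ∃ M, ∀ ξ ∈ T, G ξ k ≤ M := by
      intro k
      by_contra! h
      choose x hxT hx using h
      obtain ⟨ξ, hξ⟩ := hbdd _ (countable_range x)
      obtain ⟨ξ', hξ'T, hξ'⟩ : ∃ ξ' ∈ T, ξ ≤ ξ' := by
        by_contra! h
        exact hT ((hI ξ).mono fun η hη => (h η hη).le)
      have h1 := hmonoT _ (hxT (G ξ' k)) _ hξ'T ((hξ _ (mem_range_self _)).trans_le hξ') k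
      exact absurd (hx (G ξ' k)) (by omega)
    choose M hM using hpt
    exact hunb T hT ⟨M, fun ξ hξ => Eventually.of_forall fun k => hM k ξ hξ⟩

/-! ### Coherent sequences indexed by monotone functions. -/

/-- The graph of a family of sequences indexed by monotone functions. -/
abbrev FunctionGraph {G : Type} (A : (ℕ → ℕ) → ℕ → G) : Set ((ℕ → ℕ) × (ℕ → G)) :=
  {p | Monotone p.1 ∧ p.2 = A p.1}

theorem FunctionGraph.ext {G : Type} {A : (ℕ → ℕ) → ℕ → G} {p q : FunctionGraph A} (h : p.1.1 = q.1.1) :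
    p = q :=
  Subtype.ext (Prod.ext h (by rw [p.2.2, q.2.2, h]))

section Phase

variable {G : Type} [CommGroup G] [MetricSpace G]

/-- The distance between the phase differences of `α` and `β` at the positions `i` and `j`. -/
def phaseDist (α β : ℕ → G) (i j : ℕ) : ℝ := dist (α i / α j) (β i / β j)

/-- The phase differences of `α` and `β` are asymptotically equal along the relation `R`. -/
def PhaseClose (R : ℕ → ℕ → Prop) (α β : ℕ → G) : Prop :=
  ∀ ε > 0, ∃ N, ∀ i j, N ≤ i → N ≤ j → R i j → phaseDist α β i j ≤ ε

theorem phaseDist_comm (α β : ℕ → G) (i j : ℕ) : phaseDist α β i j = phaseDist β α i j :=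
  dist_comm _ _

theorem phaseDist_triangle (α β γ : ℕ → G) (i j : ℕ) :
    phaseDist α γ i j ≤ phaseDist α β i j + phaseDist β γ i j :=
  dist_triangle _ _ _

theorem PhaseClose.symm {R : ℕ → ℕ → Prop} {α β : ℕ → G} (h : PhaseClose R α β) :
    PhaseClose R β α := fun ε hε => by
  obtain ⟨N, hN⟩ := h ε hε
  exact ⟨N, fun i j hi hj hR => phaseDist_comm α β i j ▸ hN i j hi hj hR⟩

theorem PhaseClose.trans {R : ℕ → ℕ → Prop} {α β γ : ℕ → G} (h : PhaseClose R α β)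
    (h' : PhaseClose R β γ) : PhaseClose R α γ := fun ε hε => by
  obtain ⟨N, hN⟩ := h (ε / 2) (half_pos hε)
  obtain ⟨N', hN'⟩ := h' (ε / 2) (half_pos hε)
  refine ⟨max N N', fun i j hi hj hR => ?_⟩
  rw [max_le_iff] at hi hj
  linarith [phaseDist_triangle α β γ i j, hN i j hi.1 hj.1 hR, hN' i j hi.2 hj.2 hR]

theorem PhaseClose.mono {R R' : ℕ → ℕ → Prop} {α β : ℕ → G} (h : PhaseClose R α β)
    (hR : ∀ i j, R' i j → R i j) : PhaseClose R' α β := fun ε hε => by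
  obtain ⟨N, hN⟩ := h ε hε
  exact ⟨N, fun i j hi hj hij => hN i j hi hj (hR i j hij)⟩

theorem PhaseClose.or {R R' : ℕ → ℕ → Prop} {α β : ℕ → G} (h : PhaseClose R α β)
    (h' : PhaseClose R' α β) : PhaseClose (fun i j => R i j ∨ R' i j) α β := fun ε hε => by
  obtain ⟨N, hN⟩ := h ε hε
  obtain ⟨N', hN'⟩ := h' ε hε
  refine ⟨max N N', fun i j hi hj hR => ?_⟩
  rw [max_le_iff] at hi hj
  exact hR.elim (hN i j hi.1 hj.1) (hN' i j hi.2 hj.2)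

theorem phaseDist_mul_const {α α' β : ℕ → G} {c : G} {i j : ℕ} (hi : α' i = α i * c)
    (hj : α' j = α j * c) : phaseDist α' β i j = phaseDist α β i j := by
  rw [phaseDist, phaseDist, hi, hj, mul_div_mul_right_eq_div]

variable [IsIsometricSMul G G]

/-- Invariance of the metric turns a comparison of phase differences into the oscillation of the
quotient `α / β` between `i` and `j`. Constant factors therefore do not matter. -/
theorem phaseDist_eq (α β : ℕ → G) (i j : ℕ) :
    phaseDist α β i j = dist (α i / β i) (α j / β j) := by
  rw [phaseDist, ← dist_mul_right _ _ (α j / β i)]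
  congr 1
  · rw [div_mul_div_comm, mul_comm (α j), mul_div_mul_right_eq_div]
  · rw [div_mul_div_comm, mul_comm (β j), mul_div_mul_left_eq_div]

theorem phaseDist_swap (α β : ℕ → G) (i j : ℕ) : phaseDist α β i j = phaseDist α β j i := by
  rw [phaseDist_eq, phaseDist_eq, dist_comm]

theorem phaseDist_le (α β : ℕ → G) (i j : ℕ) :
    phaseDist α β i j ≤ dist (α i) (β i) + dist (α j) (β j) := by
  refine (dist_triangle _ (β i / α j) _).trans_eq ?_
  rw [dist_div_right, dist_div_left]

/-- The coloring has no uncountable homogeneous sets. -/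
theorem exists_ne_phaseDist_le [SecondCountableTopology G] (hTA : TodorcevicAxiom)
    {A : (ℕ → ℕ) → ℕ → G}
    (hA : ∀ f g, Monotone f → Monotone g →
      PhaseClose (fun i j => i ≤ j ∧ j ≤ f i ∧ j ≤ g i) (A f) (A g))
    {S : Set (ℕ → ℕ)} (hS : ¬ S.Countable) (hmono : ∀ f ∈ S, Monotone f) {ε : ℝ} (hε : 0 < ε) :
    ∃ f ∈ S, ∃ f' ∈ S, f ≠ f' ∧
      ∀ i j, i ≤ j → j ≤ f i → j ≤ f' i → phaseDist (A f) (A f') i j ≤ ε := by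
  obtain ⟨g, hg, hc⟩ := hTA.exists_bounded hS id
  have h1 : ∀ f ∈ {f ∈ S | ∀ᶠ n in atTop, id f n ≤ g n}, ∃ N, (∀ n, N ≤ n → f n ≤ g n) ∧
      ∀ i j, N ≤ i → N ≤ j → (i ≤ j ∧ j ≤ f i ∧ j ≤ g i) → phaseDist (A f) (A g) i j ≤ ε / 2 := by
    rintro f ⟨hfS, hf⟩
    obtain ⟨N, hN⟩ := eventually_atTop.1 hf
    obtain ⟨N', hN'⟩ := hA f g (hmono f hfS) hg (ε / 2) (half_pos hε)
    refine ⟨max N N', fun n hn => hN n (le_of_max_le_left hn), fun i j hi hj => ?_⟩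
    exact hN' i j (le_of_max_le_right hi) (le_of_max_le_right hj)
  choose! N hNg hN using h1
  have hq : ∀ x : G, ∃ n, dist x (TopologicalSpace.denseSeq G n) < ε / 4 := fun x => by
    exact (TopologicalSpace.denseRange_denseSeq G).exists_dist_lt x (by linarith : 0 < ε / 4)
  choose q hq using hq
  -- Two functions are selected with the same threshold `N`, the same value at `N`, and the same `ε
  -- / 4`-approximation of `A f` on `[0, f N]`. For `i ≥ N` both sequences are compared with `A g`;
  -- for `i < N` monotonicity puts `i` and `j` in the approximated range.
  obtain ⟨b, hb⟩ := exists_not_countable_fiber hc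
    fun f => (N f, f (N f), (List.range (f (N f) + 1)).map fun i => q (A f i))
  obtain ⟨f, ⟨hf, hfb⟩, f', ⟨hf', hfb'⟩, hne⟩ :=
    Set.not_subsingleton_iff.1 fun h => hb h.countable
  have heq := hfb.trans hfb'.symm
  simp only [Prod.mk.injEq] at heq
  obtain ⟨hNN, hMM, hL⟩ := heq
  rw [hMM, List.map_inj_left] at hL
  refine ⟨f, hf.1, f', hf'.1, hne, fun i j hij hj hj' => ?_⟩
  rcases le_or_gt (N f) i with hi | hi
  · have hi' := hNN ▸ hi
    have h1 := hN f hf i j hi (hi.trans hij) ⟨hij, hj, hj.trans (hNg f hf i hi)⟩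
    have h2 := hN f' hf' i j hi' (hi'.trans hij) ⟨hij, hj', hj'.trans (hNg f' hf' i hi')⟩
    rw [phaseDist_comm] at h2
    linarith [phaseDist_triangle (A f) (A g) (A f') i j]
  · have hM : j ≤ f' (N f') := hMM ▸ hj.trans (hmono f hf.1 hi.le)
    have key : ∀ k ≤ f' (N f'), dist (A f k) (A f' k) ≤ ε / 2 := fun k hk => by
      have h := hL k (List.mem_range.2 (by omega))
      have h1 := hq (A f k)
      have h2 := hq (A f' k)
      rw [h] at h1
      linarith [dist_triangle_right (A f k) (A f' k) (TopologicalSpace.denseSeq G (q (A f' k)))]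
    linarith [phaseDist_le (A f) (A f') i j, key i (hij.trans hM), key j hM]

/-- A cofinal set of functions is unbounded at all but finitely many arguments. -/
theorem exists_forall_unbounded {Z : Set (ℕ → ℕ)}
    (hZ : ∀ g : ℕ → ℕ, Monotone g → ∃ f ∈ Z, ∀ᶠ n in atTop, g n ≤ f n) :
    ∃ k, ∀ m, ∃ f ∈ Z, m ≤ f k := by
  by_contra! h
  choose b hb using h
  obtain ⟨g, hg, hgb⟩ := exists_monotone_eventually_ge (countable_singleton b)
  obtain ⟨f, hf, hgf⟩ := hZ g hg
  obtain ⟨n, h1, h2⟩ := ((hgb b rfl).and hgf).exists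
  exact absurd (hb n f hf) (by omega)

/-- A family that is uniformly coherent on a cofinal set is uniformized by a single sequence. -/
theorem exists_uniform_of_cofinal {A : (ℕ → ℕ) → ℕ → G}
    (hA : ∀ f g, Monotone f → Monotone g →
      PhaseClose (fun i j => i ≤ j ∧ j ≤ f i ∧ j ≤ g i) (A f) (A g))
    {Z : Set (ℕ → ℕ)} (hmono : ∀ f ∈ Z, Monotone f)
    (hcof : ∀ g : ℕ → ℕ, Monotone g → ∃ f ∈ Z, ∀ᶠ n in atTop, g n ≤ f n) {ε : ℝ} (hε : 0 < ε)
    (hZ : ∀ f ∈ Z, ∀ f' ∈ Z, ∀ i j, i ≤ j → j ≤ f i → j ≤ f' i →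
      phaseDist (A f) (A f') i j ≤ ε) :
    ∃ α : ℕ → G, ∀ f, Monotone f → ∃ N, ∀ i j, N ≤ i → i ≤ j → j ≤ f i →
      phaseDist (A f) α i j ≤ 3 * ε := by
  obtain ⟨k, hk⟩ := exists_forall_unbounded hcof
  choose φ hφZ hφ using hk
  have hle : ∀ m i, k ≤ i → m ≤ φ m i := fun m i hi => (hφ m).trans (hmono _ (hφZ m) hi)
  -- Phases count only up to a constant factor, so each `A (φ i)` is normalized at `k`. As `φ i k ≥
  -- i`, the pair `(k, i)` is controlled by all later `φ j`, and the diagonal sequence stays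
  -- `ε`-close to each of them. The factor 3 comes from the path `A f`, `A g`, `A (φ j)`, diagonal
  -- sequence.
  refine ⟨fun i => A (φ i) i / A (φ i) k, fun f hf => ?_⟩
  have hα : ∀ i j, k ≤ i → i ≤ j →
      phaseDist (A (φ j)) (fun i => A (φ i) i / A (φ i) k) i j ≤ ε := by
    intro i j hi hij
    have h := hZ _ (hφZ i) _ (hφZ j) k i hi (hle i k le_rfl) (hij.trans (hle j k le_rfl))
    rw [phaseDist_comm, phaseDist_swap, phaseDist] at h
    rw [phaseDist]
    rw [← dist_mul_right _ _ (A (φ j) j / A (φ j) k)]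
    simpa using h
  obtain ⟨g, hg, hfg⟩ := hcof f hf
  obtain ⟨N, hN⟩ := eventually_atTop.1 hfg
  obtain ⟨N', hN'⟩ := hA f g hf (hmono g hg) ε hε
  refine ⟨max k (max N N'), fun i j hi hij hj => ?_⟩
  simp only [max_le_iff] at hi
  have hjg := hj.trans (hN i hi.2.1)
  have h1 := hN' i j hi.2.2 (hi.2.2.trans hij) ⟨hij, hj, hjg⟩
  have h2 := hZ g hg _ (hφZ j) i j hij hjg (hle j i hi.1)
  have h3 := hα i j hi.1 hij
  have h4 := phaseDist_triangle (A f) (A g) (A (φ j)) i j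
  have h5 := phaseDist_triangle (A f) (A (φ j)) (fun i => A (φ i) i / A (φ i) k) i j
  linarith

/-- This is the main application of TA: uncountable homogeneous sets are excluded by
`exists_ne_phaseDist_le`, and a cofinal piece of the countable cover is handled by
`exists_uniform_of_cofinal`. -/
theorem exists_approx_uniform [SecondCountableTopology G] [IsTopologicalGroup G]
    (hTA : TodorcevicAxiom) {A : (ℕ → ℕ) → ℕ → G}
    (hA : ∀ f g, Monotone f → Monotone g →
      PhaseClose (fun i j => i ≤ j ∧ j ≤ f i ∧ j ≤ g i) (A f) (A g)) {ε : ℝ} (hε : 0 < ε) :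
    ∃ α : ℕ → G, ∀ f, Monotone f → ∃ N, ∀ i j, N ≤ i → i ≤ j → j ≤ f i →
      phaseDist (A f) α i j ≤ 3 * ε := by
  -- Since a point carries `A f` along with `f`, the phase distances are continuous and the coloring
  -- is open, although `f ↦ A f` need not be continuous.
  let K : Set (FunctionGraph A × FunctionGraph A) := {p | ∃ i j, i ≤ j ∧ j ≤ p.1.1.1 i ∧ j ≤ p.2.1.1 i ∧
    ε < phaseDist p.1.1.2 p.2.1.2 i j}
  have hK : IsOpen K := by
    have : K = ⋃ i, ⋃ j, {p : FunctionGraph A × FunctionGraph A | i ≤ j} ∩ ({p | j ≤ p.1.1.1 i} ∩ ({p | j ≤ p.2.1.1 i} ∩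
        {p | ε < phaseDist p.1.1.2 p.2.1.2 i j})) := by
      ext p; simp [K]
    rw [this]
    refine isOpen_iUnion fun i => isOpen_iUnion fun j => isOpen_const.inter ?_
    refine IsOpen.inter ?_ (IsOpen.inter ?_ ?_)
    · exact (isOpen_discrete (Ici j)).preimage (show Continuous fun p : FunctionGraph A × FunctionGraph A =>
        p.1.1.1 i by fun_prop)
    · exact (isOpen_discrete (Ici j)).preimage (show Continuous fun p : FunctionGraph A × FunctionGraph A =>
        p.2.1.1 i by fun_prop)
    · refine isOpen_lt continuous_const ?_
      unfold phaseDist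
      fun_prop
  rcases hTA.of_metrizable hK
      (fun x y ⟨i, j, h1, h2, h3, h4⟩ => ⟨i, j, h1, h3, h2, phaseDist_comm x.1.2 y.1.2 i j ▸ h4⟩)
      (fun x ⟨i, j, h1, h2, h3, h4⟩ => by simp [phaseDist] at h4; linarith) with
    ⟨Y, hYc, hY⟩ | ⟨Y, hYu, hY⟩
  · exfalso
    have hS : ¬ ((fun p : FunctionGraph A => p.1.1) '' Y).Countable := fun hc => by
      exact hYc (countable_of_injective_of_countable_image (f := fun p : FunctionGraph A => p.1.1)
        (fun p _ q _ h => FunctionGraph.ext h) hc)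
    obtain ⟨_, ⟨p, hp, rfl⟩, _, ⟨q, hq, rfl⟩, hne, h⟩ :=
      exists_ne_phaseDist_le hTA hA hS (by rintro _ ⟨p, -, rfl⟩; exact p.2.1) hε
    obtain ⟨i, j, h1, h2, h3, h4⟩ := hY p hp q hq fun he => hne (by rw [he])
    rw [p.2.2, q.2.2] at h4
    exact absurd (h i j h1 h2 h3) h4.not_ge
  · let Z : ℕ → Set (ℕ → ℕ) := fun n => {f | ∃ hf : Monotone f, (⟨(f, A f), hf, rfl⟩ : FunctionGraph A) ∈ Y n}
    -- If every piece failed to be cofinal, as witnessed by `g n`, a function dominating all `g n`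
    -- modulo finite sets would lie in no piece.
    obtain ⟨n, hn⟩ : ∃ n, ∀ g : ℕ → ℕ, Monotone g → ∃ f ∈ Z n, ∀ᶠ n in atTop, g n ≤ f n := by
      by_contra! h
      choose g hg hgZ using h
      obtain ⟨f, hf, hgf⟩ := exists_monotone_eventually_ge (countable_range g)
      obtain ⟨n, hn⟩ := mem_iUnion.1 (hYu ▸ mem_univ (⟨(f, A f), hf, rfl⟩ : FunctionGraph A))
      exact hgZ n f ⟨hf, hn⟩ ((hgf _ ⟨n, rfl⟩).mono fun m hm => hm.not_gt)
    refine exists_uniform_of_cofinal hA (fun f hf => hf.1) hn hε ?_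
    rintro f ⟨hf, hfY⟩ g ⟨hg, hgY⟩ i j hij hj hj'
    by_contra! hlt
    refine hY n _ hfY _ hgY (fun he => ?_) ⟨i, j, hij, hj, hj', hlt⟩
    have : f = g := congrArg (fun p : FunctionGraph A => p.1.1) he
    subst this
    simp [phaseDist] at hlt
    linarith

/-- Two sequences that are `ε`-close on the relation given by every function are `ε`-close
from some point on. -/
theorem exists_forall_phaseDist_le {α β : ℕ → G} {ε : ℝ}
    (h : ∀ f : ℕ → ℕ, Monotone f → ∃ N, ∀ i j, N ≤ i → i ≤ j → j ≤ f i →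
      phaseDist α β i j ≤ ε) :
    ∃ k, ∀ i j, k ≤ i → k ≤ j → phaseDist α β i j ≤ ε := by
  suffices hs : ∃ k, ∀ i j, k ≤ i → i ≤ j → phaseDist α β i j ≤ ε by
    obtain ⟨k, hk⟩ := hs
    refine ⟨k, fun i j hi hj => ?_⟩
    rcases le_total i j with hij | hij
    · exact hk i j hi hij
    · rw [phaseDist_swap]; exact hk j i hj hij
  by_contra! hcon
  choose x y hx hxy hd using hcon
  -- This monotone function catches every bad pair: `y N` is a summand at `x N` because `N ≤ x N`.
  obtain ⟨N, hN⟩ := h (fun i => ∑ k ∈ Finset.range (i + 1), y k) fun m n hmn =>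
    Finset.sum_le_sum_of_subset (Finset.range_mono (by omega))
  refine absurd (hN (x N) (y N) (hx N) (hxy N) ?_) (hd N).not_ge
  exact Finset.single_le_sum (f := y) (fun _ _ => Nat.zero_le _)
    (Finset.mem_range.2 (Nat.lt_succ_of_le (hx N)))

/-- Gluing sequences that are uniformly close from some point on. -/
theorem exists_glued {α : ℕ → ℕ → G} {ε : ℕ → ℝ} (hε : Summable ε)
    (h : ∀ n, ∃ k, ∀ i j, k ≤ i → k ≤ j → phaseDist (α n) (α (n + 1)) i j ≤ ε n) :
    ∃ β : ℕ → G, ∀ n, ∃ k, ∀ i j, k ≤ i → k ≤ j →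
      phaseDist (α n) β i j ≤ 2 * ∑' m, ε (m + n) := by
  choose k hk using h
  let K : ℕ → ℕ := fun n => n + ∑ m ∈ Finset.range (n + 1), k m
  have hKm : StrictMono K := strictMono_nat_of_lt_succ fun n => by
    simp only [K, Finset.sum_range_succ _ (n + 1)]; omega
  have hkK : ∀ n, k n ≤ K n := fun n => by
    simp only [K, Finset.sum_range_succ _ n]; omega
  -- The constants make `γ n` and `γ (n + 1)` agree at `K n`; from there on they differ by at most
  -- `ε n`.
  let c : ℕ → G := fun n => n.rec 1 fun n c => c * α n (K n) / α (n + 1) (K n)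
  have hc : ∀ n, c (n + 1) = c n * α n (K n) / α (n + 1) (K n) := fun n => rfl
  let γ : ℕ → ℕ → G := fun n i => α n i * c n
  have hε0 : ∀ n, 0 ≤ ε n := fun n => dist_nonneg.trans (hk n (k n) (k n) le_rfl le_rfl)
  have hstep : ∀ n i, K n ≤ i → dist (γ n i) (γ (n + 1) i) ≤ ε n := fun n i hi => by
    have h := hk n i (K n) ((hkK n).trans hi) (hkK n)
    rw [phaseDist] at h
    refine le_of_eq_of_le ?_ h
    rw [← dist_mul_right (_ / _) _ (c n * α n (K n))]
    simp only [γ, hc]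
    congr 1
    · rw [mul_comm (c n), ← mul_assoc, div_mul_cancel]
    · rw [div_mul_eq_mul_div, mul_div_assoc, mul_div_assoc, mul_div_assoc]
  have hdist : ∀ n m i, n ≤ m → K m ≤ i → dist (γ n i) (γ m i) ≤ ∑' l, ε (l + n) := by
    intro n m i hnm hi
    have h := dist_le_Ico_sum_of_dist_le (f := fun l => γ l i) (d := ε) hnm
      fun {l} hl hl' => hstep l i ((hKm.monotone hl'.le).trans hi)
    refine h.trans ?_
    rw [Finset.sum_Ico_eq_sum_range]
    simp_rw [add_comm n]
    exact ((summable_nat_add_iff n).2 hε).sum_le_tsum _ fun l _ => hε0 _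
  -- The glued sequence follows `γ n` on `[K n, K (n + 1))`. The search bound `i` is harmless
  -- because `n ≤ K n`.
  let N : ℕ → ℕ := fun i => Nat.findGreatest (fun n => K n ≤ i) i
  have hN : ∀ n i, K n ≤ i → n ≤ N i ∧ K (N i) ≤ i := fun n i hi =>
    ⟨Nat.le_findGreatest ((hKm.id_le n).trans hi) hi,
      Nat.findGreatest_spec (P := fun n => K n ≤ i) ((hKm.id_le n).trans hi) hi⟩
  refine ⟨fun i => γ (N i) i, fun n => ⟨K n, fun i j hi hj => ?_⟩⟩
  rw [← phaseDist_mul_const (α' := γ n) (c := c n) rfl rfl]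
  refine (phaseDist_le _ _ i j).trans ?_
  linarith [hdist n (N i) i (hN n i hi).1 (hN n i hi).2, hdist n (N j) j (hN n j hj).1 (hN n j hj).2]

/-- Under Todorcevic's Axiom, coherent families of sequences indexed by functions are trivial. -/
theorem TodorcevicAxiom.exists_uniform [SecondCountableTopology G] [IsTopologicalGroup G]
    (hTA : TodorcevicAxiom) {A : (ℕ → ℕ) → ℕ → G}
    (hA : ∀ f g, Monotone f → Monotone g →
      PhaseClose (fun i j => i ≤ j ∧ j ≤ f i ∧ j ≤ g i) (A f) (A g)) :
    ∃ α : ℕ → G, ∀ f, Monotone f → PhaseClose (fun i j => i ≤ j ∧ j ≤ f i) (A f) α := by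
  choose α hα using fun n : ℕ =>
    exists_approx_uniform hTA hA (show (0 : ℝ) < (1 / 2) ^ n by positivity)
  -- Passing through `A f`, consecutive approximations differ by at most `3 * 2⁻ⁿ + 3 * 2⁻⁽ⁿ⁺¹⁾ ≤ 6
  -- * 2⁻ⁿ`.
  have hs : Summable fun n : ℕ => 6 * (1 / 2 : ℝ) ^ n := summable_geometric_two.mul_left 6
  obtain ⟨β, hβ⟩ := exists_glued (α := α) hs fun n => exists_forall_phaseDist_le fun f hf => by
    obtain ⟨N, hN⟩ := hα n f hf
    obtain ⟨N', hN'⟩ := hα (n + 1) f hf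
    refine ⟨max N N', fun i j hi hij hj => ?_⟩
    have h1 := hN i j (le_of_max_le_left hi) hij hj
    have h2 := hN' i j (le_of_max_le_right hi) hij hj
    rw [phaseDist_comm] at h1
    have h3 := phaseDist_triangle (α n) (A f) (α (n + 1)) i j
    have h4 : (1 / 2 : ℝ) ^ (n + 1) ≤ (1 / 2) ^ n :=
      pow_le_pow_of_le_one (by norm_num) (by norm_num) (Nat.le_succ n)
    linarith
  refine ⟨β, fun f hf ε hε => ?_⟩
  have ht : Tendsto (fun n : ℕ => 3 * (1 / 2 : ℝ) ^ n + 2 * ∑' m, 6 * (1 / 2 : ℝ) ^ (m + n)) atTop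
      (𝓝 (3 * 0 + 2 * 0)) :=
    ((tendsto_pow_atTop_nhds_zero_of_lt_one (by norm_num) (by norm_num)).const_mul 3).add
      ((tendsto_sum_nat_add fun n => 6 * (1 / 2 : ℝ) ^ n).const_mul 2)
  obtain ⟨n, hn⟩ := (ht.eventually (gt_mem_nhds (by simpa using hε))).exists
  obtain ⟨N, hN⟩ := hα n f hf
  obtain ⟨k, hk⟩ := hβ n
  refine ⟨max N k, fun i j hi hj hij => ?_⟩
  rw [max_le_iff] at hi hj
  linarith [phaseDist_triangle (A f) (α n) β i j, hN i j hi.1 hij.1 hij.2, hk i j hi.2 hj.2]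

end Phase

/-! ### Interval partitions and growth functions. -/

namespace IntervalPartition

/-- `i` and `j` lie in the same interval of the partition. -/
def SameBlock (E : IntervalPartition) (i j : ℕ) : Prop := ∃ n, i ∈ E.block n ∧ j ∈ E.block n

theorem exists_mem_block (E : IntervalPartition) (i : ℕ) : ∃ n, i ∈ E.block n := by
  have h0 : E.start 0 ≤ i := by rw [E.start_zero]; exact Nat.zero_le i
  refine ⟨Nat.findGreatest (fun n => E.start n ≤ i) i,
    Nat.findGreatest_spec (P := fun n => E.start n ≤ i) (Nat.zero_le i) h0, ?_⟩
  by_contra! h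
  exact Nat.not_succ_le_self _
    (Nat.le_findGreatest (P := fun n => E.start n ≤ i) ((E.strictMono.le_apply).trans h) h)

/-- The index of the interval that contains `i`. -/
noncomputable def index (E : IntervalPartition) (i : ℕ) : ℕ := (E.exists_mem_block i).choose

theorem mem_block_index (E : IntervalPartition) (i : ℕ) : i ∈ E.block (E.index i) :=
  (E.exists_mem_block i).choose_spec

theorem eq_of_mem_block {E : IntervalPartition} {i m n : ℕ} (hm : i ∈ E.block m)
    (hn : i ∈ E.block n) : m = n := by
  have h1 : m < n + 1 := E.strictMono.lt_iff_lt.1 (hm.1.trans_lt hn.2)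
  have h2 : n < m + 1 := E.strictMono.lt_iff_lt.1 (hn.1.trans_lt hm.2)
  omega

theorem index_eq {E : IntervalPartition} {i n : ℕ} (h : i ∈ E.block n) : E.index i = n :=
  eq_of_mem_block (E.mem_block_index i) h

theorem SameBlock.index_eq {E : IntervalPartition} {i j : ℕ} (h : E.SameBlock i j) :
    E.index i = E.index j := by
  obtain ⟨n, hi, hj⟩ := h
  rw [IntervalPartition.index_eq hi, IntervalPartition.index_eq hj]

/-- The coarser partition that keeps only the left endpoints with indices `σ 0, σ 1, …`. -/
def coarsen (E : IntervalPartition) (σ : ℕ → ℕ) (h0 : σ 0 = 0) (hσ : StrictMono σ) :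
    IntervalPartition where
  start n := E.start (σ n)
  start_zero := by rw [h0, E.start_zero]
  strictMono := E.strictMono.comp hσ

/-- The intervals joined in the pattern `(0, 1), (2, 3), …`. -/
def even (E : IntervalPartition) : IntervalPartition :=
  E.coarsen (fun n => 2 * n) rfl fun m n h => by simpa using h

/-- The intervals joined in the pattern `(0), (1, 2), (3, 4), …`. -/
def odd (E : IntervalPartition) : IntervalPartition :=
  -- Truncated subtraction gives the endpoint indices `0, 1, 3, 5, …`, so the first interval stays
  -- single.
  E.coarsen (fun n => 2 * n - 1) rfl fun m n h => by simp only; omega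

/-- The partition with left endpoints `0 = s 0 < s 1 < …`, where `s (n + 1)` exceeds `f (s n)`. -/
def ofGrowth (f : ℕ → ℕ) : IntervalPartition where
  start n := n.rec 0 fun _ s => max (f s) s + 1
  start_zero := rfl
  strictMono := strictMono_nat_of_lt_succ fun _ => Nat.lt_succ_of_le (le_max_right _ _)

theorem ofGrowth_lt (f : ℕ → ℕ) (n : ℕ) : f ((ofGrowth f).start n) < (ofGrowth f).start (n + 1) :=
  Nat.lt_succ_of_le (le_max_left _ _)

theorem sameBlock_even_or_odd (E : IntervalPartition) {i j n : ℕ} (hij : i ≤ j)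
    (hi : i ∈ E.block n) (hj : j < E.start (n + 2)) : E.even.SameBlock i j ∨ E.odd.SameBlock i j := by
  have h1 : E.start n ≤ i := hi.1
  have h2 : i < E.start (n + 1) := hi.2
  have h3 : E.start (n + 1) < E.start (n + 2) := E.strictMono (by omega)
  rcases Nat.even_or_odd' n with ⟨k, rfl | rfl⟩
  · refine Or.inl ⟨k, ?_, ?_⟩ <;>
    · simp only [block, even, coarsen, mem_Ico, mul_add, mul_one]
      omega
  · refine Or.inr ⟨k + 1, ?_, ?_⟩ <;>
    · simp only [block, odd, coarsen, mem_Ico, mul_add, mul_one, show 2 * k + 2 - 1 = 2 * k + 1 by omega,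
        show 2 * k + 2 + 2 - 1 = 2 * k + 1 + 2 by omega]
      omega

/-- If `i` lies in the `n`-th interval, then `f i` lies below the end of the next one, and any two
adjacent intervals are joined in one of the two patterns. -/
theorem sameBlock_of_growth {f : ℕ → ℕ} (hf : Monotone f) {i j : ℕ} (hij : i ≤ j) (hj : j ≤ f i) :
    (ofGrowth f).even.SameBlock i j ∨ (ofGrowth f).odd.SameBlock i j :=
  sameBlock_even_or_odd _ hij (mem_block_index _ i) <|
    hj.trans_lt <| (hf (mem_block_index _ i).2.le).trans_lt (ofGrowth_lt f _)

end IntervalPartition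

/-! ### Coherent sequences indexed by interval partitions. -/

section

variable {G : Type} [CommGroup G] [MetricSpace G] [IsIsometricSMul G G]

open IntervalPartition

/-- Sequences coherent on the even and on the odd partition can be amalgamated. -/
theorem exists_amalgam (E : IntervalPartition) {α β : ℕ → G}
    (h : PhaseClose (fun i j => E.even.SameBlock i j ∧ E.odd.SameBlock i j) α β) :
    ∃ γ : ℕ → G, PhaseClose E.even.SameBlock γ α ∧ PhaseClose E.odd.SameBlock γ β := by
  let s := E.start
  let δ : ℕ → G := fun i => α i / β i
  -- Multiplying `α` by a constant on each even block does not change its phases there. An odd block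
  -- meets two consecutive even blocks; the recursion matches `γ / β` at the last endpoint `s (2 * n
  -- + 1)` inside one and the first point `s (2 * n + 2)` of the next, so `γ / β` is asymptotically
  -- constant on odd blocks.
  let c : ℕ → G := fun n => n.rec 1 fun n c => c * δ (s (2 * n + 1)) / δ (s (2 * n + 2))
  have hc : ∀ n, c (n + 1) = c n * δ (s (2 * n + 1)) / δ (s (2 * n + 2)) := fun _ => rfl
  let γ : ℕ → G := fun i => α i * c (E.even.index i)
  have hcongr : ∀ i j, E.even.SameBlock i j → phaseDist γ α i j = phaseDist α α i j :=
    fun i j hij => phaseDist_mul_const rfl (by simp only [γ, hij.index_eq])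
  refine ⟨γ, fun ε hε => ⟨0, fun i j _ _ hij => ?_⟩, fun ε hε => ?_⟩
  · rw [hcongr i j hij, phaseDist, dist_self]
    exact hε.le
  obtain ⟨N, hN⟩ := h (ε / 2) (half_pos hε)
  have key : ∀ n, s (2 * n + 1) ≥ N → ∀ i, i ∈ E.odd.block (n + 1) →
      dist (γ i / β i) (c n * δ (s (2 * n + 1))) ≤ ε / 2 := by
    intro n hn i hi
    have hmem : ∀ k, k ∈ E.odd.block (n + 1) ↔ s (2 * n + 1) ≤ k ∧ k < s (2 * n + 3) := fun k => by
      simp only [block, odd, coarsen, mem_Ico, s, show 2 * (n + 1) - 1 = 2 * n + 1 by omega,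
        show 2 * (n + 1 + 1) - 1 = 2 * n + 3 by omega]
    have hmem' : ∀ m k, k ∈ E.even.block m ↔ s (2 * m) ≤ k ∧ k < s (2 * m + 2) := fun m k => by
      simp only [block, even, coarsen, mem_Ico, s, mul_add, mul_one]
    have l1 : s (2 * n) < s (2 * n + 1) := E.strictMono (by omega)
    have l2 : s (2 * n + 1) < s (2 * n + 2) := E.strictMono (by omega)
    have l3 : s (2 * n + 2) < s (2 * n + 3) := E.strictMono (by omega)
    have l4 : s (2 * n + 3) < s (2 * n + 4) := E.strictMono (by omega)
    rw [hmem] at hi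
    have hodd : ∀ k, s (2 * n + 1) ≤ k → k < s (2 * n + 3) → E.odd.SameBlock i k := fun k hk hk' =>
      ⟨n + 1, (hmem i).2 hi, (hmem k).2 ⟨hk, hk'⟩⟩
    have hγ : γ i / β i = c (E.even.index i) * δ i := by
      simp only [γ, δ]
      rw [mul_comm (α i), mul_div_assoc]
    rw [hγ]
    rcases lt_or_ge i (s (2 * n + 2)) with hlt | hge
    · have hb : i ∈ E.even.block n := (hmem' n i).2 ⟨by omega, hlt⟩
      rw [IntervalPartition.index_eq hb, dist_mul_left, ← phaseDist_eq]
      exact hN i _ (by omega) hn ⟨⟨n, hb, (hmem' n _).2 ⟨by omega, by omega⟩⟩,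
        hodd _ le_rfl (by omega)⟩
    · have hb : i ∈ E.even.block (n + 1) := (hmem' _ i).2 ⟨by rwa [mul_add], by
        rw [show 2 * (n + 1) + 2 = 2 * n + 4 by ring]; omega⟩
      have he : c n * δ (s (2 * n + 1)) = c (n + 1) * δ (s (2 * n + 2)) := by
        rw [hc, div_mul_cancel]
      rw [IntervalPartition.index_eq hb, he, dist_mul_left, ← phaseDist_eq]
      exact hN i _ (by omega) (by omega) ⟨⟨n + 1, hb, (hmem' _ _).2 ⟨by rw [mul_add], by
        rw [show 2 * (n + 1) + 2 = 2 * n + 4 by ring]; omega⟩⟩, hodd _ (by omega) (by omega)⟩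
  refine ⟨s (2 * N + 1), fun i j hi hj ⟨n, hin, hjn⟩ => ?_⟩
  rcases n with _ | n
  · have : i < s 1 := hin.2
    have : s 1 ≤ s (2 * N + 1) := E.strictMono.monotone (by omega)
    omega
  · have hNn : N ≤ s (2 * n + 1) := by
      have h1 : i < s (2 * n + 3) := hin.2
      have h2 : 2 * N + 1 < 2 * n + 3 := E.strictMono.lt_iff_lt.1 (hi.trans_lt h1)
      have h3 : 2 * n + 1 ≤ s (2 * n + 1) := E.strictMono.id_le _
      omega
    rw [phaseDist_eq]
    linarith [dist_triangle_right (γ i / β i) (γ j / β j) (c n * δ (s (2 * n + 1))),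
      key n hNn i hin, key n hNn j hjn]

/-- Under Todorcevic's Axiom, coherent families of sequences indexed by interval partitions are
trivial. -/
theorem TodorcevicAxiom.exists_uniform_partition [SecondCountableTopology G]
    [IsTopologicalGroup G] (hTA : TodorcevicAxiom) {P : Set (IntervalPartition × (ℕ → G))}
    (hP : ∀ p ∈ P, ∀ q ∈ P,
      PhaseClose (fun i j => p.1.SameBlock i j ∧ q.1.SameBlock i j) p.2 q.2)
    (htot : ∀ E, ∃ α, (E, α) ∈ P) :
    ∃ α : ℕ → G, ∀ p ∈ P, PhaseClose p.1.SameBlock p.2 α := by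
  choose B hB using htot
  have hA : ∀ f : ℕ → ℕ, ∃ γ : ℕ → G,
      PhaseClose (ofGrowth f).even.SameBlock γ (B (ofGrowth f).even) ∧
      PhaseClose (ofGrowth f).odd.SameBlock γ (B (ofGrowth f).odd) := fun f =>
    exists_amalgam _ (hP _ (hB _) _ (hB _))
  choose A hAe hAo using hA
  have hgood : ∀ f, Monotone f → ∀ p ∈ P,
      PhaseClose (fun i j => (i ≤ j ∧ j ≤ f i) ∧ p.1.SameBlock i j) (A f) p.2 := by
    intro f hf p hp
    have he := ((hAe f).mono fun i j (h : _ ∧ p.1.SameBlock i j) => h.1).trans (hP _ (hB _) p hp)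
    have ho := ((hAo f).mono fun i j (h : _ ∧ p.1.SameBlock i j) => h.1).trans (hP _ (hB _) p hp)
    refine (he.or ho).mono fun i j h => ?_
    exact (sameBlock_of_growth hf h.1.1 h.1.2).imp (fun h' => ⟨h', h.2⟩) fun h' => ⟨h', h.2⟩
  obtain ⟨α, hα⟩ := hTA.exists_uniform (A := A) fun f g hf hg => by
    have he := ((hAe f).mono fun i j (h : (i ≤ j ∧ j ≤ g i) ∧ _) => h.2).trans
      (hgood g hg _ (hB _)).symm
    have ho := ((hAo f).mono fun i j (h : (i ≤ j ∧ j ≤ g i) ∧ _) => h.2).trans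
      (hgood g hg _ (hB _)).symm
    refine (he.or ho).mono fun i j h => ?_
    exact (sameBlock_of_growth hf h.1 h.2.1).imp (fun h' => ⟨⟨h.1, h.2.2⟩, h'⟩)
      fun h' => ⟨⟨h.1, h.2.2⟩, h'⟩
  refine ⟨α, fun p hp => ?_⟩
  -- A block containing `i` has index at most `i`, hence ends by `start (i + 1)`: this function
  -- covers all pairs from a common block.
  have hf : Monotone fun i => p.1.start (i + 1) := fun i j h =>
    p.1.strictMono.monotone (Nat.succ_le_succ h)
  have h := (hgood _ hf p hp).symm.trans ((hα _ hf).mono fun i j h => h.1)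
  intro ε hε
  obtain ⟨N, hN⟩ := h ε hε
  have hlt : ∀ i j, p.1.SameBlock i j → j ≤ p.1.start (i + 1) := by
    rintro i j ⟨n, hi, hj⟩
    have h1 : n ≤ i := (p.1.strictMono.id_le n).trans hi.1
    exact hj.2.le.trans (p.1.strictMono.monotone (Nat.succ_le_succ h1))
  refine ⟨N, fun i j hi hj hij => ?_⟩
  rcases le_total i j with hle | hle
  · exact hN i j hi hj ⟨⟨hle, hlt i j hij⟩, hij⟩
  · have hji : p.1.SameBlock j i := hij.imp fun n h => h.symm
    rw [phaseDist_swap]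
    exact hN j i hj hi ⟨⟨hle, hlt j i hji⟩, hji⟩

end

/-! ### Diagonal operators, coordinate projections and compactness. -/

section Diagonal

open scoped BoundedContinuousFunction InnerProductSpace

variable {H : Type*} [NormedAddCommGroup H] [InnerProductSpace ℂ H] (e : HilbertBasis ℕ ℂ H)

/-- Multiplication by a bounded sequence on `ℓ²`. -/
noncomputable def lpMultiplication (c : ℕ →ᵇ ℂ) :
    lp (fun _ : ℕ => ℂ) 2 →L[ℂ] lp (fun _ : ℕ => ℂ) 2 :=
  have hmem : ∀ f : lp (fun _ : ℕ => ℂ) 2, Memℓp (fun n => c n * f n) 2 := fun f => by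
    refine memℓp_gen ?_
    refine Summable.of_nonneg_of_le (fun _ => by positivity) (fun n => ?_)
      (((lp.memℓp f).summable (by norm_num)).mul_left (‖c‖ ^ (2 : ENNReal).toReal))
    rw [norm_mul, Real.mul_rpow (norm_nonneg _) (norm_nonneg _)]
    gcongr
    exact c.norm_coe_le_norm n
  LinearMap.mkContinuous
    { toFun := fun f => ⟨fun n => c n * f n, hmem f⟩
      map_add' := fun f g => by ext n; exact mul_add _ _ _
      map_smul' := fun r f => by ext n; simp [mul_left_comm] }
    ‖c‖ fun f => by
      refine lp.norm_le_of_tsum_le (by norm_num) (by positivity) ?_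
      rw [Real.mul_rpow (norm_nonneg _) (norm_nonneg _),
        lp.norm_rpow_eq_tsum (by norm_num), ← tsum_mul_left]
      refine Summable.tsum_le_tsum (fun n => ?_) ((hmem f).summable (by norm_num))
        (((lp.memℓp f).summable (by norm_num)).mul_left _)
      change ‖c n * f n‖ ^ _ ≤ _
      rw [norm_mul, Real.mul_rpow (norm_nonneg _) (norm_nonneg _)]
      gcongr
      exact c.norm_coe_le_norm n

/-- The diagonal operator with entries `c`. -/
noncomputable def diagOp (c : ℕ →ᵇ ℂ) : H →L[ℂ] H :=
  (e.repr.symm.toContinuousLinearEquiv : lp (fun _ : ℕ => ℂ) 2 →L[ℂ] H) ∘L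
    lpMultiplication c ∘L (e.repr.toContinuousLinearEquiv : H →L[ℂ] lp (fun _ : ℕ => ℂ) 2)

theorem norm_diagOp_le (c : ℕ →ᵇ ℂ) {C : ℝ} (hC : 0 ≤ C) (hc : ∀ n, ‖c n‖ ≤ C) :
    ‖diagOp e c‖ ≤ C := by
  refine ContinuousLinearMap.opNorm_le_bound _ hC fun x => ?_
  have h1 : ‖diagOp e c x‖ = ‖lpMultiplication c (e.repr x)‖ := e.repr.symm.norm_map _
  rw [h1, ← e.repr.norm_map x]
  refine (ContinuousLinearMap.le_opNorm _ _).trans ?_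
  gcongr
  refine le_trans ?_ ((BoundedContinuousFunction.norm_le hC).2 hc)
  unfold lpMultiplication
  exact LinearMap.mkContinuous_norm_le _ (norm_nonneg c) _

theorem diagOp_basis (c : ℕ →ᵇ ℂ) (i : ℕ) : diagOp e c (e i) = c i • e i := by
  classical
  have h : diagOp e c (e i) = e.repr.symm (lpMultiplication c (e.repr (e i))) := rfl
  rw [h, LinearIsometryEquiv.symm_apply_eq, map_smul, e.repr_self]
  ext n
  change c n * (lp.single 2 i (1 : ℂ) : lp (fun _ : ℕ => ℂ) 2) n = c i * (lp.single 2 i (1 : ℂ) : lp (fun _ : ℕ => ℂ) 2) n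
  rcases eq_or_ne n i with rfl | hn
  · rfl
  · simp [lp.single_apply, hn]

variable {e}

theorem HilbertBasis.clm_ext {a b : H →L[ℂ] H} (h : ∀ i, a (e i) = b (e i)) : a = b := by
  refine ContinuousLinearMap.ext_on (s := Set.range e) ?_ ?_
  · rw [dense_iff_closure_eq, ← Submodule.topologicalClosure_coe, e.dense_span, Submodule.top_coe]
  · rintro _ ⟨i, rfl⟩
    exact h i

theorem HilbertBasis.ext_entry {x y : H} (h : ∀ j, ⟪e j, x⟫_ℂ = ⟪e j, y⟫_ℂ) : x = y := by
  refine e.repr.injective ?_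
  ext j
  rw [e.repr_apply_apply, e.repr_apply_apply, h]

theorem HilbertBasis.inner_eq (e : HilbertBasis ℕ ℂ H) (i j : ℕ) :
    ⟪e i, e j⟫_ℂ = if i = j then 1 else 0 :=
  orthonormal_iff_ite.1 e.orthonormal i j

theorem HilbertBasis.norm_eq (e : HilbertBasis ℕ ℂ H) (i : ℕ) : ‖e i‖ = 1 := e.orthonormal.1 i

variable (e)

theorem diagOp_mul (c d : ℕ →ᵇ ℂ) : diagOp e (c * d) = diagOp e c * diagOp e d :=
  e.clm_ext fun i => by
    simp [diagOp_basis, smul_smul, mul_comm]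

theorem diagOp_sub (c d : ℕ →ᵇ ℂ) : diagOp e (c - d) = diagOp e c - diagOp e d :=
  e.clm_ext fun i => by simp [diagOp_basis, sub_smul]

theorem diagOp_one : diagOp e 1 = 1 :=
  e.clm_ext fun i => by simp [diagOp_basis]

theorem diagOp_comm (c d : ℕ →ᵇ ℂ) : diagOp e c * diagOp e d = diagOp e d * diagOp e c := by
  rw [← diagOp_mul, mul_comm, diagOp_mul]

theorem inner_diagOp (c : ℕ →ᵇ ℂ) (j : ℕ) (x : H) : ⟪e j, diagOp e c x⟫_ℂ = c j * ⟪e j, x⟫_ℂ := by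
  rw [← e.repr_apply_apply, ← e.repr_apply_apply]
  have h : diagOp e c x = e.repr.symm (lpMultiplication c (e.repr x)) := rfl
  rw [h, LinearIsometryEquiv.apply_symm_apply]
  rfl

theorem star_diagOp [CompleteSpace H] (c : ℕ →ᵇ ℂ) : star (diagOp e c) = diagOp e (star c) :=
  e.clm_ext fun i => e.ext_entry fun j => by
    rw [ContinuousLinearMap.star_eq_adjoint, ContinuousLinearMap.adjoint_inner_right, diagOp_basis,
      diagOp_basis, inner_smul_left, inner_smul_right, e.inner_eq]
    split_ifs with h
    · subst h; rfl
    · simp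

/-- The indicator function of a set of natural numbers. -/
noncomputable def indicatorFn (A : Set ℕ) : ℕ →ᵇ ℂ :=
  BoundedContinuousFunction.ofNormedAddCommGroupDiscrete (A.indicator 1) 1 fun n => by
    by_cases h : n ∈ A <;> simp [h]

/-- The projection onto the closed span of the basis vectors with indices in `A`. -/
noncomputable def coordProj (A : Set ℕ) : H →L[ℂ] H := diagOp e (indicatorFn A)

theorem indicatorFn_of_mem {A : Set ℕ} {n : ℕ} (h : n ∈ A) : indicatorFn A n = 1 := by
  simp [indicatorFn, h]

theorem indicatorFn_of_notMem {A : Set ℕ} {n : ℕ} (h : n ∉ A) : indicatorFn A n = 0 := by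
  simp [indicatorFn, h]

theorem coordProj_basis_of_mem {A : Set ℕ} {n : ℕ} (h : n ∈ A) : coordProj e A (e n) = e n := by
  rw [coordProj, diagOp_basis, indicatorFn_of_mem h, one_smul]

theorem coordProj_basis_of_notMem {A : Set ℕ} {n : ℕ} (h : n ∉ A) : coordProj e A (e n) = 0 := by
  rw [coordProj, diagOp_basis, indicatorFn_of_notMem h, zero_smul]

theorem norm_coordProj_le (A : Set ℕ) : ‖coordProj e A‖ ≤ 1 :=
  norm_diagOp_le e _ zero_le_one fun n => by
    by_cases h : n ∈ A <;> simp [indicatorFn, h]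

theorem coordProj_mul (A B : Set ℕ) : coordProj e A * coordProj e B = coordProj e (A ∩ B) := by
  rw [coordProj, coordProj, coordProj, ← diagOp_mul]
  congr 1
  ext n
  by_cases h : n ∈ A <;> by_cases h' : n ∈ B <;> simp [indicatorFn, h, h']

theorem coordProj_compl (A : Set ℕ) : coordProj e Aᶜ = 1 - coordProj e A :=
  e.clm_ext fun n => by
    by_cases h : n ∈ A
    · simp [coordProj_basis_of_mem e h, coordProj_basis_of_notMem e (show n ∉ Aᶜ from not_not.2 h)]
    · simp [coordProj_basis_of_notMem e h, coordProj_basis_of_mem e (show n ∈ Aᶜ from h)]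

theorem star_coordProj [CompleteSpace H] (A : Set ℕ) : star (coordProj e A) = coordProj e A := by
  rw [coordProj, star_diagOp]
  congr 1
  ext n
  by_cases h : n ∈ A <;> simp [indicatorFn, h]

theorem coordProj_finset (s : Finset ℕ) :
    coordProj e s = ∑ i ∈ s, (innerSL ℂ (e i)).smulRight (e i) :=
  e.clm_ext fun n => by
    rw [_root_.sum_apply]
    simp only [ContinuousLinearMap.smulRight_apply, innerSL_apply_apply, e.inner_eq, ite_smul,
      one_smul, zero_smul, Finset.sum_ite_eq']
    split_ifs with h
    · exact coordProj_basis_of_mem e h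
    · exact coordProj_basis_of_notMem e h

theorem isCompactOperator_coordProj (s : Finset ℕ) : IsCompactOperator (coordProj e s) := by
  rw [← mem_compactIdeal, coordProj_finset]
  refine sum_mem fun i _ => ?_
  have h : IsCompactOperator (innerSL ℂ (e i) : H →L[ℂ] ℂ) :=
    isCompactOperator_of_locallyCompactSpace_dom _
  exact h.clm_comp (ContinuousLinearMap.toSpanSingleton ℂ (e i))

theorem isCompactOperator_coordProj_Iio (n : ℕ) : IsCompactOperator (coordProj e (Iio n)) := by
  have := isCompactOperator_coordProj e (Finset.Iio n)
  rwa [Finset.coe_Iio] at this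

theorem tendsto_coordProj_Iio (x : H) :
    Tendsto (fun n => coordProj e (Iio n) x) atTop (𝓝 x) := by
  have h := (e.hasSum_repr x).tendsto_sum_nat
  refine h.congr fun n => ?_
  rw [← Finset.coe_Iio, coordProj_finset, _root_.sum_apply]
  refine Finset.sum_congr (by ext; simp) fun i _ => ?_
  simp [e.repr_apply_apply]

theorem coordProj_Ici (n : ℕ) : coordProj e (Ici n) = 1 - coordProj e (Iio n) := by
  rw [← coordProj_compl, compl_Iio]

variable {e}

theorem isCompactOperator_of_forall_approx [CompleteSpace H] {S : H →L[ℂ] H}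
    (h : ∀ ε > 0, ∃ T : H →L[ℂ] H, IsCompactOperator T ∧ ‖S - T‖ ≤ ε) : IsCompactOperator S := by
  have hc : IsClosed {T : H →L[ℂ] H | IsCompactOperator T} := isClosed_setOfPred_isCompactOperator
  refine hc.closure_subset (Metric.mem_closure_iff.2 fun ε hε => ?_)
  obtain ⟨T, hT, hle⟩ := h (ε / 2) (half_pos hε)
  exact ⟨T, hT, by rw [dist_eq_norm]; linarith⟩

/-- The tail projections are contractions tending to zero pointwise, so they are uniformly small on
the totally bounded image of the unit ball. -/
theorem IsCompactOperator.norm_coordProj_mul_le {S : H →L[ℂ] H} (hS : IsCompactOperator S) {ε : ℝ}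
    (hε : 0 < ε) : ∃ N, ∀ n, N ≤ n → ‖coordProj e (Ici n) * S‖ ≤ ε := by
  have h1 : TotallyBounded (S '' Metric.closedBall 0 1) :=
    (hS.isCompact_closure_image_closedBall (𝕜₁ := ℂ) (f := S.toLinearMap)
      1).totallyBounded.subset subset_closure
  obtain ⟨t, htf, ht⟩ := Metric.totallyBounded_iff.1 h1 (ε / 2) (half_pos hε)
  have h2 : ∀ᶠ n in atTop, ∀ y ∈ t, ‖coordProj e (Ici n) y‖ < ε / 2 := by
    rw [eventually_all_finite htf]
    intro y _
    have h := tendsto_iff_norm_sub_tendsto_zero.1 (tendsto_coordProj_Iio e y)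
    filter_upwards [h.eventually (gt_mem_nhds (half_pos hε))] with n hn
    rw [coordProj_Ici, _root_.sub_apply, norm_sub_rev]
    exact hn
  obtain ⟨N, hN⟩ := eventually_atTop.1 h2
  refine ⟨N, fun n hn => ContinuousLinearMap.opNorm_le_of_unit_norm (𝕜 := ℂ) hε.le fun x hx => ?_⟩
  obtain ⟨y, hy, hxy⟩ := mem_iUnion₂.1 (ht (mem_image_of_mem S (by simp [hx] : x ∈ Metric.closedBall 0 1)))
  rw [Metric.mem_ball, dist_eq_norm] at hxy
  have h3 : (coordProj e (Ici n) * S) x = coordProj e (Ici n) (S x - y) + coordProj e (Ici n) y := by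
    rw [map_sub, sub_add_cancel]; rfl
  rw [h3]
  have h4 := (coordProj e (Ici n)).le_of_opNorm_le (norm_coordProj_le e _) (S x - y)
  linarith [norm_add_le (coordProj e (Ici n) (S x - y)) (coordProj e (Ici n) y), hN n hn y hy]

theorem IsCompactOperator.norm_mul_coordProj_le [CompleteSpace H] {S : H →L[ℂ] H}
    (hS : IsCompactOperator S) {ε : ℝ} (hε : 0 < ε) :
    ∃ N, ∀ n, N ≤ n → ‖S * coordProj e (Ici n)‖ ≤ ε := by
  obtain ⟨N, hN⟩ := (isCompactOperator_star hS).norm_coordProj_mul_le (e := e) hε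
  refine ⟨N, fun n hn => ?_⟩
  rw [← norm_star, star_mul, star_coordProj]
  exact hN n hn

theorem IsCompactOperator.norm_entry_le {S : H →L[ℂ] H} (hS : IsCompactOperator S) {ε : ℝ}
    (hε : 0 < ε) : ∃ N, ∀ j, N ≤ j → ∀ i, ‖⟪e j, S (e i)⟫_ℂ‖ ≤ ε := by
  obtain ⟨N, hN⟩ := hS.norm_coordProj_mul_le (e := e) hε
  refine ⟨N, fun j hj i => ?_⟩
  have h : ⟪e j, S (e i)⟫_ℂ = ⟪e j, (coordProj e (Ici N) * S) (e i)⟫_ℂ := by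
    change _ = ⟪e j, diagOp e _ (S (e i))⟫_ℂ
    rw [inner_diagOp, indicatorFn_of_mem (show j ∈ Ici N from hj), one_mul]
  rw [h]
  refine (norm_inner_le_norm _ _).trans ?_
  rw [e.norm_eq, one_mul]
  refine (ContinuousLinearMap.le_opNorm _ _).trans ?_
  rw [e.norm_eq, mul_one]
  exact hN N le_rfl

theorem isCompactOperator_diagOp [CompleteSpace H] {c : ℕ →ᵇ ℂ}
    (hc : ∀ ε > 0, ∃ N, ∀ n, N ≤ n → ‖c n‖ ≤ ε) : IsCompactOperator (diagOp e c) := by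
  refine isCompactOperator_of_forall_approx fun ε hε => ?_
  obtain ⟨N, hN⟩ := hc ε hε
  refine ⟨diagOp e c * coordProj e (Iio N), (isCompactOperator_coordProj_Iio e N).clm_comp (diagOp e c), ?_⟩
  rw [coordProj, ← diagOp_mul, ← diagOp_sub]
  refine norm_diagOp_le e _ hε.le fun n => ?_
  rcases lt_or_ge n N with h | h
  · simp [indicatorFn_of_mem (show n ∈ Iio N from h), hε.le]
  · simp [indicatorFn_of_notMem (show n ∉ Iio N from not_lt.2 h), hN n h]

end Diagonal

/-! ### The commutant of the diagonal operators modulo the compacts. -/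

section Commutant

open scoped BoundedContinuousFunction InnerProductSpace

variable {H : Type*} [NormedAddCommGroup H] [InnerProductSpace ℂ H] (e : HilbertBasis ℕ ℂ H)

/-- The sequence that is `-1` on `A` and `1` off `A`. -/
noncomputable def signFn (A : Set ℕ) : ℕ →ᵇ ℂ := 1 - 2 • indicatorFn A

theorem signFn_of_mem {A : Set ℕ} {n : ℕ} (h : n ∈ A) : signFn A n = -1 := by
  simp [signFn, indicatorFn_of_mem h]; norm_num

theorem signFn_of_notMem {A : Set ℕ} {n : ℕ} (h : n ∉ A) : signFn A n = 1 := by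
  simp [signFn, indicatorFn_of_notMem h]

theorem signFn_mul_self (A : Set ℕ) : signFn A * signFn A = 1 := by
  ext n
  by_cases h : n ∈ A <;> simp [signFn_of_mem, signFn_of_notMem, h]

theorem diagOp_signFn (A : Set ℕ) : diagOp e (signFn A) = 1 - 2 • coordProj e A :=
  e.clm_ext fun i => by
    by_cases h : i ∈ A
    · simp [diagOp_basis, signFn_of_mem h, coordProj_basis_of_mem e h, two_smul]
    · simp [diagOp_basis, signFn_of_notMem h, coordProj_basis_of_notMem e h]

variable {e}

theorem entry_diagOp_mul_mul (c d : ℕ →ᵇ ℂ) (T : H →L[ℂ] H) (i j : ℕ) :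
    ⟪e j, (diagOp e c * T * diagOp e d) (e i)⟫_ℂ = c j * d i * ⟪e j, T (e i)⟫_ℂ := by
  change ⟪e j, diagOp e c (T (diagOp e d (e i)))⟫_ℂ = _
  rw [inner_diagOp, diagOp_basis, map_smul, inner_smul_right, mul_assoc]

/-- Toggling membership of `i` in `A` reverses the sign of each term. Averaging over all signs thus
kills the off-diagonal entries. -/
theorem sum_signFn_mul_signFn {I : Finset ℕ} {i j : ℕ} (hi : i ∈ I) (hij : j ≠ i) :
    ∑ A ∈ I.powerset, signFn (A : Set ℕ) j * signFn (A : Set ℕ) i = 0 := by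
  classical
  refine Finset.sum_involution (fun A _ => symmDiff A {i}) ?_ ?_ ?_ ?_
  · intro A _
    have h1 : signFn (symmDiff A {i} : Finset ℕ) j = signFn (A : Set ℕ) j := by
      by_cases h : j ∈ A
      · rw [signFn_of_mem (Finset.mem_coe.2 h), signFn_of_mem]
        simp [Set.mem_symmDiff, h, hij]
      · rw [signFn_of_notMem (mt Finset.mem_coe.1 h), signFn_of_notMem]
        simp [Set.mem_symmDiff, h, hij]
    have h2 : signFn (symmDiff A {i} : Finset ℕ) i = - signFn (A : Set ℕ) i := by
      by_cases h : i ∈ A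
      · rw [signFn_of_mem (Finset.mem_coe.2 h), signFn_of_notMem, neg_neg]
        simp [Set.mem_symmDiff, h]
      · rw [signFn_of_notMem (mt Finset.mem_coe.1 h), signFn_of_mem]
        simp [Set.mem_symmDiff, h]
    rw [h1, h2]; ring
  · intro A _ _ h
    have := congrArg (i ∈ ·) h
    by_cases hA : i ∈ A <;> simp [Finset.mem_symmDiff, hA] at this
  · intro A hA
    rw [Finset.mem_powerset] at hA ⊢
    intro k hk
    rw [Finset.mem_symmDiff, Finset.mem_singleton] at hk
    rcases hk with hk | hk
    · exact hA hk.1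
    · exact hk.1 ▸ hi
  · intro A _
    simp

/-- A finite matrix with zero diagonal is the average of its differences from its conjugates by
diagonal signs. -/
theorem norm_corner_le_of_forall_sign {T : H →L[ℂ] H} (hT : ∀ i, ⟪e i, T (e i)⟫_ℂ = 0)
    {I : Finset ℕ} {δ : ℝ}
    (h : ∀ A ⊆ I, ‖coordProj e I * (T - diagOp e (signFn A) * T * diagOp e (signFn A)) *
      coordProj e I‖ ≤ δ) : ‖coordProj e I * T * coordProj e I‖ ≤ δ := by
  have h0 : ∑ A ∈ I.powerset, coordProj e I *
      (diagOp e (signFn (A : Set ℕ)) * T * diagOp e (signFn (A : Set ℕ))) * coordProj e I = 0 := by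
    refine e.clm_ext fun i => e.ext_entry fun j => ?_
    rw [_root_.sum_apply, inner_sum]
    simp only [coordProj, entry_diagOp_mul_mul, _root_.zero_apply, inner_zero_right]
    by_cases hi : i ∈ I
    · rcases eq_or_ne j i with rfl | hij
      · simp [hT]
      · simp_rw [← mul_assoc, mul_assoc (indicatorFn (I : Set ℕ) j * indicatorFn (I : Set ℕ) i)]
        rw [← Finset.mul_sum, ← Finset.sum_mul, sum_signFn_mul_signFn hi hij]
        simp
    · simp [indicatorFn_of_notMem (mt Finset.mem_coe.1 hi)]
  have h1 : (2 : ℝ) ^ I.card * ‖coordProj e I * T * coordProj e I‖ ≤ 2 ^ I.card * δ := by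
    have h2 : ∑ A ∈ I.powerset, coordProj e I *
        (T - diagOp e (signFn (A : Set ℕ)) * T * diagOp e (signFn (A : Set ℕ))) * coordProj e I
        = (2 : ℂ) ^ I.card • (coordProj e I * T * coordProj e I) := by
      simp only [mul_sub, sub_mul, Finset.sum_sub_distrib]
      rw [h0, sub_zero, Finset.sum_const, Finset.card_powerset, ← Nat.cast_smul_eq_nsmul ℂ]
      simp
    have h3 := norm_sum_le_of_le I.powerset fun A hA => h A (Finset.mem_powerset.1 hA)
    rw [h2, norm_smul] at h3
    simpa using h3
  exact le_of_mul_le_mul_left h1 (by positivity)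

/-- Bounds on the finite corners of an operator pass to the limit. -/
theorem norm_corner_le_of_forall_Ico {T : H →L[ℂ] H} {N : ℕ} {δ : ℝ}
    (h : ∀ M, ‖coordProj e (Ico N M) * T * coordProj e (Ico N M)‖ ≤ δ) :
    ‖coordProj e (Ici N) * T * coordProj e (Ici N)‖ ≤ δ := by
  have hδ : 0 ≤ δ := (norm_nonneg _).trans (h 0)
  have hI : ∀ M, coordProj e (Ico N M) = coordProj e (Iio M) * coordProj e (Ici N) := fun M => by
    rw [coordProj_mul]; congr 1; ext; simp [and_comm]
  have h1 : ∀ K M, K ≤ M → ∀ x, ‖coordProj e (Iio M) (coordProj e (Ici N)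
      (T (coordProj e (Ici N) (coordProj e (Iio K) x))))‖ ≤ δ * ‖x‖ := by
    intro K M hKM x
    have hx : coordProj e (Iio M) (coordProj e (Ici N)
        (T (coordProj e (Ici N) (coordProj e (Iio K) x)))) =
        (coordProj e (Ico N M) * T * coordProj e (Ico N M)) (coordProj e (Iio K) x) := by
      have h2 : coordProj e (Ici N) * coordProj e (Iio K)
          = coordProj e (Ico N M) * coordProj e (Iio K) := by
        rw [coordProj_mul, coordProj_mul]
        congr 1; ext; simp; omega
      have h3 : coordProj e (Ici N) (coordProj e (Iio K) x)
          = coordProj e (Ico N M) (coordProj e (Iio K) x) := DFunLike.congr_fun h2 x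
      rw [h3]
      exact (DFunLike.congr_fun (hI M) _).symm
    rw [hx]
    refine (ContinuousLinearMap.le_of_opNorm_le _ (h M) _).trans ?_
    gcongr
    simpa using (coordProj e (Iio K)).le_of_opNorm_le (norm_coordProj_le e _) x
  have h2 : ∀ K x, ‖coordProj e (Ici N) (T (coordProj e (Ici N) (coordProj e (Iio K) x)))‖
      ≤ δ * ‖x‖ := fun K x => by
    refine le_of_tendsto (tendsto_coordProj_Iio e _).norm ?_
    filter_upwards [eventually_ge_atTop K] with M hM using h1 K M hM x
  refine ContinuousLinearMap.opNorm_le_bound _ hδ fun x => ?_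
  have hc := (((coordProj e (Ici N) * T * coordProj e (Ici N)).continuous.tendsto x).comp
    (tendsto_coordProj_Iio e x)).norm
  exact le_of_tendsto hc (Eventually.of_forall fun K => h2 K x)

variable [CompleteSpace H]

theorem isCompactOperator_of_forall_corner {T : H →L[ℂ] H}
    (h : ∀ δ > 0, ∃ N, ∀ M, ‖coordProj e (Ico N M) * T * coordProj e (Ico N M)‖ ≤ δ) :
    IsCompactOperator T := by
  refine isCompactOperator_of_forall_approx fun δ hδ => ?_
  obtain ⟨N, hN⟩ := h δ hδ
  refine ⟨T - coordProj e (Ici N) * T * coordProj e (Ici N), ?_, ?_⟩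
  · have h1 := isCompactOperator_coordProj_Iio e N
    rw [← mem_compactIdeal] at h1 ⊢
    have h2 : T - coordProj e (Ici N) * T * coordProj e (Ici N)
        = T * coordProj e (Iio N) + coordProj e (Iio N) * (T - T * coordProj e (Iio N)) := by
      rw [coordProj_Ici]; noncomm_ring
    rw [h2]
    exact add_mem (Ideal.mul_mem_left _ _ h1) (Ideal.mul_mem_right _ _ h1)
  · rw [sub_sub_cancel]
    exact norm_corner_le_of_forall_Ico hN

/-- An operator with zero diagonal that commutes modulo compact operators with all coordinate
projections is compact. -/
theorem isCompactOperator_of_commutator_of_diag_eq_zero {T : H →L[ℂ] H}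
    (hT : ∀ i, ⟪e i, T (e i)⟫_ℂ = 0)
    (hcomm : ∀ A, IsCompactOperator (T * coordProj e A - coordProj e A * T)) :
    IsCompactOperator T := by
  refine isCompactOperator_of_forall_corner (e := e) ?_
  by_contra! hcon
  obtain ⟨δ, hδ, hcon⟩ := hcon
  have h1 : ∀ N, ∃ M, ∃ A ⊆ Finset.Ico N M, δ < ‖coordProj e (Finset.Ico N M : Finset ℕ) *
      (T - diagOp e (signFn A) * T * diagOp e (signFn A)) * coordProj e (Finset.Ico N M : Finset ℕ)‖ := by
    intro N
    obtain ⟨M, hM⟩ := hcon N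
    refine ⟨M, ?_⟩
    by_contra! h
    rw [← Finset.coe_Ico] at hM
    exact hM.not_ge (norm_corner_le_of_forall_sign hT h)
  choose M A hA hlt using h1
  have hNM : ∀ N, N < M N := fun N => by
    by_contra! h
    have h2 := hlt N
    rw [Finset.Ico_eq_empty_of_le h] at h2
    have h3 : coordProj e ((∅ : Finset ℕ) : Set ℕ) = 0 :=
      e.clm_ext fun i => coordProj_basis_of_notMem e (by simp)
    rw [h3] at h2
    simp at h2
    linarith
  -- If the corners stay large, there are consecutive intervals, each with a sign change that moves
  -- `T` by more than `δ` there. The union `U` of the sign sets realizes all these changes at once,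
  -- so the commutator with its projection cannot be compact.
  let E : IntervalPartition := ⟨fun n => n.rec 0 fun _ s => M s, rfl,
    strictMono_nat_of_lt_succ fun n => hNM _⟩
  let U : Set ℕ := {i | ∃ k, i ∈ A (E.start k)}
  have hU : ∀ k, ∀ i ∈ Finset.Ico (E.start k) (M (E.start k)),
      signFn U i = signFn (A (E.start k)) i := by
    intro k i hi
    by_cases h : i ∈ A (E.start k)
    · rw [signFn_of_mem (Finset.mem_coe.2 h), signFn_of_mem (show i ∈ U from ⟨k, h⟩)]
    · rw [signFn_of_notMem (mt Finset.mem_coe.1 h), signFn_of_notMem]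
      rintro ⟨l, hl⟩
      have h2 := Finset.mem_Ico.1 (hA _ hl)
      have h3 := Finset.mem_Ico.1 hi
      have : l = k := IntervalPartition.eq_of_mem_block (E := E) (i := i) h2 h3
      exact h (this ▸ hl)
  have hUc : ∀ k, coordProj e (Finset.Ico (E.start k) (M (E.start k)) : Finset ℕ) * diagOp e (signFn U) =
      coordProj e (Finset.Ico (E.start k) (M (E.start k)) : Finset ℕ) *
        diagOp e (signFn (A (E.start k))) := by
    intro k
    rw [coordProj, ← diagOp_mul, ← diagOp_mul]
    congr 1
    ext i
    by_cases hi : i ∈ Finset.Ico (E.start k) (M (E.start k))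
    · simp [hU k i hi]
    · have h0 := indicatorFn_of_notMem (mt Finset.mem_coe.1 hi)
      simp only [BoundedContinuousFunction.coe_mul, Pi.mul_apply, h0, zero_mul]
  have hcpt : IsCompactOperator (T - diagOp e (signFn U) * T * diagOp e (signFn U)) := by
    have h2 := hcomm U
    rw [← mem_compactIdeal] at h2 ⊢
    have h3 : T = T * diagOp e (signFn U) * diagOp e (signFn U) := by
      rw [mul_assoc, ← diagOp_mul, signFn_mul_self, diagOp_one, mul_one]
    have h4 : T - diagOp e (signFn U) * T * diagOp e (signFn U)
        = (-2 : H →L[ℂ] H) * (T * coordProj e U - coordProj e U * T) * diagOp e (signFn U) := by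
      nth_rw 1 [h3]
      rw [← sub_mul]
      congr 1
      rw [diagOp_signFn]
      noncomm_ring
    rw [h4]
    exact Ideal.mul_mem_right _ _ (Ideal.mul_mem_left _ _ h2)
  obtain ⟨n, hn⟩ := hcpt.norm_coordProj_mul_le (e := e) hδ
  have hnE : n ≤ E.start n := E.strictMono.le_apply
  set P := coordProj e (Finset.Ico (E.start n) (M (E.start n)) : Finset ℕ) with hP
  have h5 : P * (T - diagOp e (signFn U) * T * diagOp e (signFn U)) * P =
      P * (T - diagOp e (signFn (A (E.start n))) * T * diagOp e (signFn (A (E.start n)))) * P := by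
    have h6 : diagOp e (signFn U) * P = diagOp e (signFn (A (E.start n))) * P := by
      rw [hP, coordProj, diagOp_comm, diagOp_comm e (signFn (A _))]
      exact hUc n
    rw [mul_sub, mul_sub, sub_mul, sub_mul]
    congr 1
    calc _ = (P * diagOp e (signFn U)) * T * (diagOp e (signFn U) * P) := by noncomm_ring
      _ = _ := by rw [h6, hP, hUc n]; noncomm_ring
  have h7 := hlt (E.start n)
  rw [← hP, ← h5] at h7
  refine absurd h7 (not_lt.2 ?_)
  have h8 : P = P * coordProj e (Ici n) := by
    rw [hP, coordProj_mul]
    congr 1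
    ext i
    simp
    omega
  set C := T - diagOp e (signFn U) * T * diagOp e (signFn U)
  calc ‖P * C * P‖ = ‖P * (coordProj e (Ici n) * C) * P‖ := by
        nth_rw 1 [h8]; rw [mul_assoc P]
    _ ≤ ‖P‖ * ‖coordProj e (Ici n) * C‖ * ‖P‖ :=
        (norm_mul_le _ _).trans (by gcongr; exact norm_mul_le _ _)
    _ ≤ 1 * δ * 1 := by
        gcongr
        · exact norm_coordProj_le e _
        · exact hn n le_rfl
        · exact norm_coordProj_le e _
    _ = δ := by ring

/-- An operator that commutes modulo compact operators with all coordinate projections is a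
compact perturbation of a diagonal operator. -/
theorem exists_diagOp_sub_compact {T : H →L[ℂ] H}
    (hcomm : ∀ A, IsCompactOperator (T * coordProj e A - coordProj e A * T)) :
    ∃ c : ℕ →ᵇ ℂ, IsCompactOperator (T - diagOp e c) := by
  let c : ℕ →ᵇ ℂ := BoundedContinuousFunction.ofNormedAddCommGroupDiscrete
    (fun i => ⟪e i, T (e i)⟫_ℂ) ‖T‖ fun i => by
      refine (norm_inner_le_norm _ _).trans ?_
      simpa [e.norm_eq] using T.le_opNorm (e i)
  refine ⟨c, isCompactOperator_of_commutator_of_diag_eq_zero (e := e) (fun i => ?_) fun A => ?_⟩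
  · rw [_root_.sub_apply, inner_sub_right, diagOp_basis, inner_smul_right, e.inner_eq]
    simp [c]
  · have h : (T - diagOp e c) * coordProj e A - coordProj e A * (T - diagOp e c)
        = T * coordProj e A - coordProj e A * T := by
      rw [sub_mul, mul_sub, coordProj, diagOp_comm]
      abel
    rw [h]
    exact hcomm A

end Commutant

/-! ### Generation of the bounded operators by block diagonal ones. -/

section BlockDiagonal

open scoped BoundedContinuousFunction InnerProductSpace

variable {H : Type*} [NormedAddCommGroup H] [InnerProductSpace ℂ H] {e : HilbertBasis ℕ ℂ H}

/-- An operator whose matrix is supported on the blocks of `E` belongs to `D[E]`. -/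
theorem mem_fddAlgebra_of_entries {E : IntervalPartition} {a : H →L[ℂ] H}
    (h : ∀ i j, ⟪e j, a (e i)⟫_ℂ ≠ 0 → E.SameBlock i j) : a ∈ fddAlgebra e E := by
  intro n x hx
  have hle : Submodule.span ℂ ((fun i => e i) '' E.block n) ≤
      (Submodule.span ℂ ((fun i => e i) '' E.block n)).comap a.toLinearMap := by
    rw [Submodule.span_le]
    rintro _ ⟨i, hi, rfl⟩
    have h1 : HasSum (fun j => e.repr (a (e i)) j • e j)
        (∑ j ∈ Finset.Ico (E.start n) (E.start (n + 1)), e.repr (a (e i)) j • e j) := by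
      refine hasSum_sum_of_ne_finset_zero fun j hj => ?_
      have h2 : e.repr (a (e i)) j = 0 := by
        rw [e.repr_apply_apply]
        by_contra hne
        obtain ⟨m, hm, hm'⟩ := h i j hne
        rw [IntervalPartition.eq_of_mem_block hm hi] at hm'
        exact hj (Finset.mem_Ico.2 hm')
      rw [h2, zero_smul]
    have h3 : a (e i) = _ := (e.hasSum_repr (a (e i))).unique h1
    change a (e i) ∈ Submodule.span ℂ ((fun i => e i) '' E.block n)
    rw [h3]
    refine Submodule.sum_mem _ fun j hj => Submodule.smul_mem _ _ (Submodule.subset_span ?_)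
    exact ⟨j, Finset.mem_Ico.1 hj, rfl⟩
  exact hle hx

theorem diagOp_mem_fddAlgebra (c : ℕ →ᵇ ℂ) (E : IntervalPartition) :
    diagOp e c ∈ fddAlgebra e E := by
  refine mem_fddAlgebra_of_entries fun i j h => ?_
  rw [diagOp_basis, inner_smul_right, e.inner_eq] at h
  have hij : j = i := by
    by_contra hne
    simp [hne] at h
  exact ⟨_, E.mem_block_index i, hij ▸ E.mem_block_index i⟩

/-- Members of `D[E]` commute with diagonal operators that are constant on the blocks of `E`. -/
theorem diagOp_mul_comm_of_mem_fddAlgebra {E : IntervalPartition} {a : H →L[ℂ] H}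
    (ha : a ∈ fddAlgebra e E) {c : ℕ →ᵇ ℂ} (hc : ∀ i j, E.SameBlock i j → c i = c j) :
    diagOp e c * a = a * diagOp e c := by
  refine e.clm_ext fun i => ?_
  have h : ∀ y ∈ Submodule.span ℂ ((fun i => e i) '' E.block (E.index i)),
      diagOp e c y = c i • y := by
    intro y hy
    induction hy using Submodule.span_induction with
    | mem x hx =>
      obtain ⟨j, hj, rfl⟩ := hx
      simp only
      rw [diagOp_basis, hc j i ⟨_, hj, E.mem_block_index i⟩]
    | zero => simp
    | add x y _ _ hx hy => rw [map_add, hx, hy, smul_add]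
    | smul r x _ hx => rw [map_smul, hx, smul_comm]
  have hi : e i ∈ Submodule.span ℂ ((fun i => e i) '' E.block (E.index i)) :=
    Submodule.subset_span ⟨i, E.mem_block_index i, rfl⟩
  change diagOp e c (a (e i)) = a (diagOp e c (e i))
  rw [h _ (ha _ _ hi), diagOp_basis, map_smul]

variable (e) in
/-- The operator that permutes the basis vectors. -/
noncomputable def permOp [CompleteSpace H] (σ : Equiv.Perm ℕ) : H →L[ℂ] H :=
  let b : HilbertBasis ℕ ℂ H := HilbertBasis.mk (v := e ∘ σ)
    (e.orthonormal.comp _ σ.injective) (by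
      rw [Set.range_comp, σ.range_eq_univ, Set.image_univ, e.dense_span])
  ((e.repr.trans b.repr.symm).toContinuousLinearEquiv : H →L[ℂ] H)

theorem permOp_basis [CompleteSpace H] (σ : Equiv.Perm ℕ) (i : ℕ) :
    permOp e σ (e i) = e (σ i) := by
  classical
  simp only [permOp]
  change (HilbertBasis.repr _).symm (e.repr (e i)) = _
  rw [e.repr_self, HilbertBasis.repr_symm_single, HilbertBasis.coe_mk]
  rfl

/-- Every operator can be sparsely cut so that the corners far from the diagonal are small. -/
theorem exists_small_corners [CompleteSpace H] (a : H →L[ℂ] H) {η : ℝ} (hη : 0 < η) (N : ℕ) :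
    ∃ M, N < M ∧ ‖coordProj e (Ici M) * a * coordProj e (Iio N)‖ ≤ η ∧
      ‖coordProj e (Iio N) * a * coordProj e (Ici M)‖ ≤ η := by
  have h := isCompactOperator_coordProj_Iio e N
  have h1 : IsCompactOperator (a * coordProj e (Iio N) : H →L[ℂ] H) := h.clm_comp a
  have h2 : IsCompactOperator (coordProj e (Iio N) * a : H →L[ℂ] H) := h.comp_clm a
  obtain ⟨M₁, hM₁⟩ := h1.norm_coordProj_mul_le (e := e) hη
  obtain ⟨M₂, hM₂⟩ := h2.norm_mul_coordProj_le (e := e) hη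
  refine ⟨max (N + 1) (max M₁ M₂), by simp, ?_, hM₂ _ (by simp)⟩
  rw [mul_assoc]
  exact hM₁ _ (by simp)

theorem entry_coordProj_mul_mul (A B : Set ℕ) (a : H →L[ℂ] H) (i j : ℕ) [Decidable (j ∈ A ∧ i ∈ B)] :
    ⟪e j, (coordProj e A * a * coordProj e B) (e i)⟫_ℂ =
      if j ∈ A ∧ i ∈ B then ⟪e j, a (e i)⟫_ℂ else 0 := by
  rw [coordProj, coordProj, entry_diagOp_mul_mul]
  by_cases hj : j ∈ A <;> by_cases hi : i ∈ B <;>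
    simp [indicatorFn, hi, hj]

/-- Every operator is a compact perturbation of one that is block tridiagonal for some
partition. -/
theorem exists_tridiagonal [CompleteSpace H] (e : HilbertBasis ℕ ℂ H) (a : H →L[ℂ] H) :
    ∃ E : IntervalPartition, ∃ t : H →L[ℂ] H, IsCompactOperator (a - t) ∧
      ∀ i j, ⟪e j, t (e i)⟫_ℂ ≠ 0 → E.index j ≤ E.index i + 1 ∧ E.index i ≤ E.index j + 1 := by
  classical
  choose M hlt hM₁ hM₂ using fun n N : ℕ => exists_small_corners (e := e) a
    (show (0 : ℝ) < (1 / 2) ^ n by positivity) N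
  let E : IntervalPartition := ⟨fun n => n.rec 0 fun n s => M n s, rfl,
    strictMono_nat_of_lt_succ fun n => hlt _ _⟩
  -- The part of the rows and columns of block `n` lying at least two blocks further out. Its norm
  -- is at most `2⁻ⁿ`, so the sum of these parts is compact.
  let k : ℕ → H →L[ℂ] H := fun n =>
    coordProj e (Ici (E.start (n + 2))) * a * coordProj e (E.block n) +
      coordProj e (E.block n) * a * coordProj e (Ici (E.start (n + 2)))
  have hb : ∀ n, coordProj e (E.block n) =
      coordProj e (Iio (E.start (n + 1))) * coordProj e (E.block n) := fun n => by
    rw [coordProj_mul]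
    congr 1
    ext i
    simp only [IntervalPartition.block, mem_Ico, mem_inter_iff, mem_Iio]
    omega
  have hb' : ∀ n, coordProj e (E.block n) =
      coordProj e (E.block n) * coordProj e (Iio (E.start (n + 1))) := fun n => by
    rw [coordProj, coordProj, diagOp_comm]
    exact hb n
  have hk : ∀ n, ‖k n‖ ≤ (1 / 2) ^ n := by
    intro n
    have h1 : ‖coordProj e (Ici (E.start (n + 2))) * a * coordProj e (E.block n)‖
        ≤ (1 / 2) ^ (n + 1) := by
      rw [hb, ← mul_assoc]
      refine (norm_mul_le _ _).trans ?_
      exact (mul_le_mul (hM₁ (n + 1) _) (norm_coordProj_le e _) (norm_nonneg _)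
        (by positivity)).trans_eq (mul_one _)
    have h2 : ‖coordProj e (E.block n) * a * coordProj e (Ici (E.start (n + 2)))‖
        ≤ (1 / 2) ^ (n + 1) := by
      rw [hb', mul_assoc, mul_assoc, ← mul_assoc (coordProj e (Iio _))]
      refine (norm_mul_le _ _).trans ?_
      exact (mul_le_mul (norm_coordProj_le e _) (hM₂ (n + 1) _) (norm_nonneg _)
        zero_le_one).trans_eq (one_mul _)
    refine (norm_add_le _ _).trans ((add_le_add h1 h2).trans_eq ?_)
    rw [pow_succ]; ring
  have hs : Summable k := Summable.of_norm_bounded summable_geometric_two hk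
  have hcomp : ∀ n, IsCompactOperator (k n) := by
    intro n
    have h : coordProj e (E.block n) ∈ compactIdeal H := by
      have h1 := isCompactOperator_coordProj e (Finset.Ico (E.start n) (E.start (n + 1)))
      rw [Finset.coe_Ico] at h1
      exact h1
    exact add_mem (Ideal.mul_mem_left _ _ h) (Ideal.mul_mem_right _ _ (Ideal.mul_mem_right _ _ h))
  refine ⟨E, a - ∑' n, k n, ?_, fun i j h => ?_⟩
  · rw [sub_sub_cancel]
    refine isCompactOperator_of_tendsto hs.hasSum.tendsto_sum_nat (Eventually.of_forall fun n => ?_)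
    exact (compactIdeal H).sum_mem fun i _ => hcomp i
  by_contra hcon
  apply h
  have hentry : HasSum (fun n => ⟪e j, k n (e i)⟫_ℂ) ⟪e j, (∑' n, k n) (e i)⟫_ℂ :=
    (hs.hasSum.mapL (ContinuousLinearMap.apply ℂ H (e i))).mapL (innerSL ℂ (e j))
  have hmem : ∀ i n, i ∈ E.block n ↔ n = E.index i := fun i n =>
    ⟨fun h => (IntervalPartition.index_eq h).symm, fun h => h ▸ E.mem_block_index i⟩
  have hmem' : ∀ i n, i ∈ Ici (E.start n) ↔ n ≤ E.index i := by
    intro i n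
    have h1 := E.mem_block_index i
    constructor
    · intro hi
      exact Nat.lt_succ_iff.1 (E.strictMono.lt_iff_lt.1 ((mem_Ici.1 hi).trans_lt h1.2))
    · intro hn
      exact (E.strictMono.monotone hn).trans h1.1
  have hval : ∀ n, ⟪e j, k n (e i)⟫_ℂ =
      (if n + 2 ≤ E.index j ∧ n = E.index i then ⟪e j, a (e i)⟫_ℂ else 0) +
      if n = E.index j ∧ n + 2 ≤ E.index i then ⟪e j, a (e i)⟫_ℂ else 0 := by
    intro n
    simp only [k, _root_.add_apply, inner_add_right, entry_coordProj_mul_mul, hmem, hmem']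
  -- An entry two or more blocks off the diagonal occurs in exactly one `k n`, for the smaller block
  -- index.
  have hone : ∑' n, ⟪e j, k n (e i)⟫_ℂ = ⟪e j, a (e i)⟫_ℂ := by
    rw [tsum_eq_single (min (E.index i) (E.index j))]
    · rw [hval]
      split_ifs <;> first | omega | simp
    · intro n hn
      rw [hval]
      split_ifs <;> first | omega | simp
  rw [_root_.sub_apply, inner_sub_right, ← hentry.tsum_eq, hone, sub_self]

/-- The intervals joined in the pattern `(0, 1, 2), (3, 4, 5), …`. -/
def IntervalPartition.triple (E : IntervalPartition) : IntervalPartition :=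
  E.coarsen (fun n => 3 * n) rfl fun m n h => by simpa using h

/-- The intervals joined in the pattern `(0, 1), (2, 3, 4), (5, 6, 7), …`. -/
def IntervalPartition.shiftedTriple (E : IntervalPartition) : IntervalPartition :=
  E.coarsen (fun n => 3 * n - 1) rfl fun m n h => by simp only; omega

theorem IntervalPartition.sameBlock_coarsen {E : IntervalPartition} {σ : ℕ → ℕ} {h0 : σ 0 = 0}
    {hσ : StrictMono σ} {i j n : ℕ} (hi : σ n ≤ E.index i) (hi' : E.index i < σ (n + 1))
    (hj : σ n ≤ E.index j) (hj' : E.index j < σ (n + 1)) : (E.coarsen σ h0 hσ).SameBlock i j :=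
  ⟨n, ⟨(E.strictMono.monotone hi).trans (E.mem_block_index i).1,
      (E.mem_block_index i).2.trans_le (E.strictMono.monotone hi')⟩,
    (E.strictMono.monotone hj).trans (E.mem_block_index j).1,
      (E.mem_block_index j).2.trans_le (E.strictMono.monotone hj')⟩

/-- The union of the algebras `D[E]` spans the bounded operators modulo the compact ones. -/
theorem closure_fddAlgebra_union_compact [CompleteSpace H] (e : HilbertBasis ℕ ℂ H) :
    AddSubgroup.closure ({a : H →L[ℂ] H | ∃ E, a ∈ fddAlgebra e E} ∪ {a | IsCompactOperator a})
      = ⊤ := by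
  classical
  rw [eq_top_iff]
  intro a _
  obtain ⟨E, t, hat, ht⟩ := exists_tridiagonal e a
  set S := AddSubgroup.closure
    ({a : H →L[ℂ] H | ∃ E, a ∈ fddAlgebra e E} ∪ {a | IsCompactOperator a})
  suffices h : t ∈ S by
    rw [← sub_add_cancel a t]
    exact add_mem (AddSubgroup.subset_closure (Or.inr hat)) h
  -- Modulo 3, unlike modulo 2, the residues of adjacent block indices determine which of the two
  -- comes first.
  let p : ℕ → H →L[ℂ] H := fun r => coordProj e {i | E.index i % 3 = r}
  have hp : ∑ r ∈ Finset.range 3, p r = 1 := e.clm_ext fun i => by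
    have hpi : ∀ r, p r (e i) = if E.index i % 3 = r then e i else 0 := fun r => by
      split_ifs with h
      · exact coordProj_basis_of_mem e h
      · exact coordProj_basis_of_notMem e h
    rw [_root_.sum_apply]
    simp only [hpi, Finset.sum_ite_eq, Finset.mem_range]
    rw [if_pos (Nat.mod_lt _ (by norm_num))]
    rfl
  have hsum : t = ∑ r ∈ Finset.range 3, ∑ s ∈ Finset.range 3, p r * t * p s := by
    simp_rw [← Finset.mul_sum, hp, mul_one, ← Finset.sum_mul, hp, one_mul]
  rw [hsum]
  refine sum_mem fun r hr => sum_mem fun s hs => AddSubgroup.subset_closure (Or.inl ?_)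
  rw [Finset.mem_range] at hr hs
  have hne : ∀ i j, ⟪e j, (p r * t * p s) (e i)⟫_ℂ ≠ 0 → E.index j % 3 = r ∧ E.index i % 3 = s ∧
      E.index j ≤ E.index i + 1 ∧ E.index i ≤ E.index j + 1 := by
    intro i j h
    simp only [p, entry_coordProj_mul_mul] at h
    split_ifs at h with h'
    · exact ⟨h'.1, h'.2, ht i j h⟩
    · exact absurd rfl h
  -- The residues are then 0 and 2, and adjacent indices are `3m + 2` and `3m + 3`, which only the
  -- shifted triples join; all other combinations fit into plain triples.
  by_cases hrs : r + s = 2 ∧ r ≠ s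
  · refine ⟨E.shiftedTriple, mem_fddAlgebra_of_entries fun i j h => ?_⟩
    obtain ⟨h1, h2, h3, h4⟩ := hne i j h
    refine IntervalPartition.sameBlock_coarsen (n := (E.index i + 1) / 3) ?_ ?_ ?_ ?_ <;> omega
  · refine ⟨E.triple, mem_fddAlgebra_of_entries fun i j h => ?_⟩
    obtain ⟨h1, h2, h3, h4⟩ := hne i j h
    refine IntervalPartition.sameBlock_coarsen (n := E.index i / 3) ?_ ?_ ?_ ?_ <;> omega

end BlockDiagonal

/-! ### The invariant metric on the circle. -/

section CircleMetric

theorem Circle.dist_eq_norm_sub (x y : Circle) : dist x y = ‖(x : ℂ) - (y : ℂ)‖ :=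
  dist_eq_norm (x : ℂ) (y : ℂ)

instance : IsIsometricSMul Circle Circle :=
  ⟨fun c => Isometry.of_dist_eq fun x y => by
    rw [Circle.dist_eq_norm_sub, Circle.dist_eq_norm_sub, smul_eq_mul, smul_eq_mul, Circle.coe_mul,
      Circle.coe_mul, ← mul_sub, norm_mul, Circle.norm_coe, one_mul]⟩

instance : SecondCountableTopology Circle :=
  inferInstanceAs (SecondCountableTopology (Metric.sphere (0 : ℂ) 1))

end CircleMetric

/-! ### Diagonal unitaries in the Calkin algebra and uniformization. -/

section Phases

open scoped BoundedContinuousFunction InnerProductSpace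

variable {H : Type*} [NormedAddCommGroup H] [InnerProductSpace ℂ H] (e : HilbertBasis ℕ ℂ H)

/-- A unimodular sequence as a bounded function. -/
noncomputable def circleFn (α : ℕ → Circle) : ℕ →ᵇ ℂ :=
  BoundedContinuousFunction.ofNormedAddCommGroupDiscrete (fun n => (α n : ℂ)) 1
    fun n => (Circle.norm_coe (α n)).le

@[simp] theorem circleFn_apply (α : ℕ → Circle) (n : ℕ) : circleFn α n = α n := rfl

/-- The diagonal unitary with entries `α`. -/
noncomputable def phaseOp (α : ℕ → Circle) : H →L[ℂ] H := diagOp e (circleFn α)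

theorem phaseOp_mul (α β : ℕ → Circle) :
    phaseOp e (fun n => α n * β n) = phaseOp e α * phaseOp e β := by
  rw [phaseOp, phaseOp, phaseOp, ← diagOp_mul]
  congr 1

theorem star_circleFn_mul (α : ℕ → Circle) : star (circleFn α) * circleFn α = 1 := by
  ext n
  change (starRingEnd ℂ) (α n : ℂ) * (α n : ℂ) = 1
  rw [← Complex.normSq_eq_conj_mul_self]
  simp

theorem calkinMk_eq_iff {a b : H →L[ℂ] H} :
    calkinMk H a = calkinMk H b ↔ IsCompactOperator (a - b) :=
  Ideal.Quotient.eq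

/-- An operator into a finite-dimensional subspace is compact. -/
theorem isCompactOperator_of_mul_eq_zero {u p : H →L[ℂ] H}
    [FiniteDimensional ℂ (LinearMap.ker u.toLinearMap)] (h : u * p = 0) : IsCompactOperator p := by
  have : ProperSpace (LinearMap.ker u.toLinearMap) := FiniteDimensional.proper ℂ _
  have h1 : IsCompactOperator (p.codRestrict (LinearMap.ker u.toLinearMap)
      fun x => DFunLike.congr_fun h x) := isCompactOperator_of_locallyCompactSpace_dom _
  exact h1.clm_comp (LinearMap.ker u.toLinearMap).subtypeL

variable [CompleteSpace H]

theorem star_phaseOp_mul (α : ℕ → Circle) : star (phaseOp e α) * phaseOp e α = 1 := by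
  rw [phaseOp, star_diagOp, ← diagOp_mul, star_circleFn_mul, diagOp_one]

theorem phaseOp_mul_star (α : ℕ → Circle) : phaseOp e α * star (phaseOp e α) = 1 := by
  rw [phaseOp, star_diagOp, ← diagOp_mul, mul_comm, star_circleFn_mul, diagOp_one]

theorem calkinMk_phaseOp_eq {α β : ℕ → Circle}
    (h : ∀ ε > 0, ∃ N, ∀ n, N ≤ n → dist (α n) (β n) ≤ ε) :
    calkinMk H (phaseOp e α) = calkinMk H (phaseOp e β) := by
  rw [calkinMk_eq_iff, phaseOp, phaseOp, ← diagOp_sub]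
  refine isCompactOperator_diagOp fun ε hε => ?_
  obtain ⟨N, hN⟩ := h ε hε
  exact ⟨N, fun n hn => (Circle.dist_eq_norm_sub (α n) (β n)).symm.trans_le (hN n hn)⟩

theorem calkinMk_conjBy (u a : H →L[ℂ] H) :
    calkinMk H (conjBy u a) = calkinMk H u * calkinMk H a * star (calkinMk H u) := by
  rw [conjBy, map_mul, map_mul, calkinMk_star]

variable {e}

/-- Asymptotically equal phases on the blocks of `E` act equally on `D[E]` modulo compact
operators. -/
theorem calkinMk_conjBy_phaseOp_eq {E : IntervalPartition} {α β : ℕ → Circle}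
    (h : PhaseClose E.SameBlock α β) {a : H →L[ℂ] H} (ha : a ∈ fddAlgebra e E) :
    calkinMk H (conjBy (phaseOp e α) a) = calkinMk H (conjBy (phaseOp e β) a) := by
  -- The quotient `α / β` frozen at the left endpoint of each block: `α` is asymptotically `β * γ`,
  -- and the diagonal unitary of `γ` commutes with `D[E]`.
  let γ : ℕ → Circle := fun i => α (E.start (E.index i)) / β (E.start (E.index i))
  have hstart : ∀ n, E.start n ∈ E.block n := fun n => ⟨le_rfl, E.strictMono (Nat.lt_succ_self n)⟩
  have hα : calkinMk H (phaseOp e α) = calkinMk H (phaseOp e fun n => β n * γ n) := by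
    refine calkinMk_phaseOp_eq e fun ε hε => ?_
    obtain ⟨N, hN⟩ := h ε hε
    refine ⟨E.start N, fun n hn => ?_⟩
    have h1 : N ≤ E.index n :=
      Nat.lt_succ_iff.1 (E.strictMono.lt_iff_lt.1 (hn.trans_lt (E.mem_block_index n).2))
    have h2 : N ≤ E.start (E.index n) := h1.trans E.strictMono.le_apply
    have h3 := hN n _ (h2.trans (E.mem_block_index n).1) h2 ⟨_, E.mem_block_index n, hstart _⟩
    rw [phaseDist_eq] at h3
    calc dist (α n) (β n * γ n) = dist (β n * (α n / β n)) (β n * γ n) := by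
          rw [mul_div_cancel]
      _ ≤ ε := by rw [dist_mul_left]; exact h3
  have hγ : phaseOp e γ * a = a * phaseOp e γ :=
    diagOp_mul_comm_of_mem_fddAlgebra ha fun i j hij => by simp [γ, hij.index_eq]
  rw [calkinMk_conjBy, hα, ← calkinMk_conjBy]
  congr 1
  rw [conjBy, conjBy, phaseOp_mul, star_mul]
  calc _ = phaseOp e β * (phaseOp e γ * a) * (star (phaseOp e γ) * star (phaseOp e β)) := by
        rw [mul_assoc (phaseOp e β) (phaseOp e γ) a]
    _ = phaseOp e β * a * (phaseOp e γ * star (phaseOp e γ)) * star (phaseOp e β) := by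
        rw [hγ]; noncomm_ring
    _ = _ := by rw [phaseOp_mul_star, mul_one]

/-- If two diagonal unitaries act equally on `D[E] ∩ D[F]` modulo compact operators, then their
phases are asymptotically equal on the common blocks. -/
theorem phaseClose_of_calkinMk_conjBy_eq {E F : IntervalPartition} {α β : ℕ → Circle}
    (h : ∀ a ∈ fddAlgebra e E ∩ fddAlgebra e F,
      calkinMk H (conjBy (phaseOp e α) a) = calkinMk H (conjBy (phaseOp e β) a)) :
    PhaseClose (fun i j => E.SameBlock i j ∧ F.SameBlock i j) α β := by
  classical
  by_contra hcon
  unfold PhaseClose at hcon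
  push Not at hcon
  obtain ⟨ε, hε, hcon⟩ := hcon
  choose i j hi hj hR hlt using hcon
  -- Bad pairs are placed in disjoint intervals. Swapping the two basis vectors of each pair gives
  -- one operator in both algebras, and its conjugates have the phase differences as matrix entries.
  let B : IntervalPartition := ⟨fun n => n.rec 0 fun _ s => max (i s) (j s) + 1, rfl,
    strictMono_nat_of_lt_succ fun n => Nat.lt_succ_of_le ((hi _).trans (le_max_left _ _))⟩
  let x : ℕ → ℕ := fun n => i (B.start n)
  let y : ℕ → ℕ := fun n => j (B.start n)
  have hx : ∀ n, x n ∈ B.block n := fun n => ⟨hi _, Nat.lt_succ_of_le (le_max_left _ _)⟩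
  have hy : ∀ n, y n ∈ B.block n := fun n => ⟨hj _, Nat.lt_succ_of_le (le_max_right _ _)⟩
  let f : ℕ → ℕ := fun n => Equiv.swap (x (B.index n)) (y (B.index n)) n
  have hindex : ∀ n, B.index (f n) = B.index n := by
    intro n
    simp only [f, Equiv.swap_apply_def]
    split_ifs
    · exact IntervalPartition.index_eq (hy _)
    · exact IntervalPartition.index_eq (hx _)
    · rfl
  have hinv : Function.Involutive f := fun n => by
    change Equiv.swap (x (B.index (f n))) (y (B.index (f n))) (f n) = n
    rw [hindex]
    exact Equiv.swap_apply_self _ _ _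
  let a : H →L[ℂ] H := permOp e hinv.toPerm
  have ha : ∀ n, a (e n) = e (f n) := fun n => permOp_basis _ n
  have hmem : ∀ G : IntervalPartition, (∀ N, G.SameBlock (i N) (j N)) → a ∈ fddAlgebra e G := by
    intro G hG
    refine mem_fddAlgebra_of_entries fun k l hne => ?_
    have hl : l = f k := by
      by_contra hlk
      rw [ha, e.inner_eq, if_neg hlk] at hne
      exact hne rfl
    rw [hl]
    simp only [f, Equiv.swap_apply_def]
    split_ifs with h1 h2
    · nth_rw 1 [h1]
      exact hG _
    · nth_rw 1 [h2]
      obtain ⟨n, hn, hn'⟩ := hG (B.start (B.index k))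
      exact ⟨n, hn', hn⟩
    · exact ⟨_, G.mem_block_index k, G.mem_block_index k⟩
  have hc := calkinMk_eq_iff.1 (h a ⟨hmem E fun N => (hR N).1, hmem F fun N => (hR N).2⟩)
  obtain ⟨N, hN⟩ := hc.norm_entry_le (e := e) hε
  have hfx : f (y N) = x N := by
    simp only [f, IntervalPartition.index_eq (hy N), Equiv.swap_apply_right]
  have hNx : N ≤ x N := (B.strictMono.le_apply (x := N)).trans (hx N).1
  have hle := hN (x N) hNx (y N)
  have hentry : ∀ γ : ℕ → Circle, ⟪e (x N), conjBy (phaseOp e γ) a (e (y N))⟫_ℂ =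
      ((γ (x N) / γ (y N) : Circle) : ℂ) := by
    intro γ
    rw [conjBy, phaseOp, star_diagOp, entry_diagOp_mul_mul, ha, hfx, e.inner_eq, if_pos rfl,
      mul_one, div_eq_mul_inv, Circle.coe_mul, Circle.coe_inv_eq_conj]
    rfl
  rw [_root_.sub_apply, inner_sub_right, hentry, hentry, ← Circle.dist_eq_norm_sub] at hle
  exact absurd hle (hlt (B.start N)).not_ge

/-- The operators `star u * u - 1` and `u * star u - 1` take values in the finite-dimensional
kernels of `u` and `star u`. -/
theorem IsCofinitePartialIsometry.calkinMk_mem_unitary {u : H →L[ℂ] H}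
    (hu : IsCofinitePartialIsometry u) : calkinMk H u ∈ unitary (Calkin H) := by
  obtain ⟨h1, h2, h3⟩ := hu
  rw [Unitary.mem_iff, ← calkinMk_star, ← map_mul, ← map_mul, ← map_one (calkinMk H),
    calkinMk_eq_iff, calkinMk_eq_iff]
  have h4 : star u * u * star u = star u := by
    have h := congrArg star h1
    rwa [star_mul, star_mul, star_star, ← mul_assoc] at h
  constructor
  · refine isCompactOperator_of_mul_eq_zero (u := u) ?_
    rw [mul_sub, ← mul_assoc, h1, mul_one, sub_self]
  · refine isCompactOperator_of_mul_eq_zero (u := star u) ?_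
    rw [mul_sub, ← mul_assoc, h4, mul_one, sub_self]

theorem IsCofinitePartialIsometry.mul_phaseOp {u : H →L[ℂ] H} (hu : IsCofinitePartialIsometry u)
    (α : ℕ → Circle) : IsCofinitePartialIsometry (u * phaseOp e α) := by
  obtain ⟨h1, h2, h3⟩ := hu
  refine ⟨?_, ?_, ?_⟩
  · rw [star_mul]
    calc _ = u * (phaseOp e α * star (phaseOp e α)) * star u * u * phaseOp e α := by noncomm_ring
      _ = _ := by rw [phaseOp_mul_star, mul_one, h1]
  · refine Submodule.finiteDimensional_of_le (S₂ := (LinearMap.ker u.toLinearMap).map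
      (star (phaseOp e α) : H →L[ℂ] H).toLinearMap) fun x hx => ⟨phaseOp e α x, hx, ?_⟩
    exact DFunLike.congr_fun (star_phaseOp_mul e α) x
  · refine Submodule.finiteDimensional_of_le (S₂ := LinearMap.ker
      (star u : H →L[ℂ] H).toLinearMap) fun x hx => ?_
    have h4 : (star (phaseOp e α) * star u : H →L[ℂ] H) x = 0 := by
      rw [← star_mul]; exact hx
    have h5 : (phaseOp e α * (star (phaseOp e α) * star u) : H →L[ℂ] H) x = 0 := by
      change phaseOp e α ((star (phaseOp e α) * star u : H →L[ℂ] H) x) = 0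
      rw [h4, map_zero]
    rwa [← mul_assoc, phaseOp_mul_star, one_mul] at h5

/-- With `z` the phase of `c`, the left side is `|‖c‖ - 1|`, a factor of `|‖c‖² - 1|` whose cofactor
`‖c‖ + 1` is at least 1. For `c = 0` the default argument gives `z = 1`. -/
theorem exists_circle_norm_sub_le (c : ℂ) : ∃ z : Circle, ‖c - z‖ ≤ ‖c * star c - 1‖ := by
  refine ⟨Circle.exp c.arg, ?_⟩
  have h1 : c - Circle.exp c.arg = ((‖c‖ - 1 : ℝ) : ℂ) * Circle.exp c.arg := by
    have := Complex.norm_mul_exp_arg_mul_I c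
    rw [Circle.coe_exp]
    push_cast
    rw [sub_mul, this, one_mul]
  have h2 : c * star c - 1 = ((‖c‖ ^ 2 - 1 : ℝ) : ℂ) := by
    rw [show star c = (starRingEnd ℂ) c from rfl, Complex.mul_conj, Complex.normSq_eq_norm_sq]
    push_cast
    rfl
  rw [h1, h2, norm_mul, Circle.norm_coe, mul_one, Complex.norm_real, Complex.norm_real,
    show ‖c‖ ^ 2 - 1 = (‖c‖ - 1) * (‖c‖ + 1) by ring, norm_mul]
  refine le_mul_of_one_le_right (norm_nonneg _) ?_
  rw [Real.norm_of_nonneg (by positivity)]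
  linarith [norm_nonneg c]

/-- A diagonal operator that is unitary modulo compact operators is a compact perturbation of a
diagonal unitary. -/
theorem exists_phaseOp_of_unitary {c : ℕ →ᵇ ℂ}
    (hc : calkinMk H (diagOp e c) * star (calkinMk H (diagOp e c)) = 1) :
    ∃ α : ℕ → Circle, calkinMk H (diagOp e c) = calkinMk H (phaseOp e α) := by
  rw [← calkinMk_star, ← map_mul, ← map_one (calkinMk H), calkinMk_eq_iff, star_diagOp,
    ← diagOp_mul, ← diagOp_one e, ← diagOp_sub] at hc
  choose α hα using fun n => exists_circle_norm_sub_le (c n)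
  refine ⟨α, ?_⟩
  rw [calkinMk_eq_iff, phaseOp, ← diagOp_sub]
  refine isCompactOperator_diagOp fun ε hε => ?_
  obtain ⟨N, hN⟩ := hc.norm_entry_le (e := e) hε
  refine ⟨N, fun n hn => (hα n).trans ?_⟩
  have h := hN n hn n
  rw [diagOp_basis, inner_smul_right, e.inner_eq, if_pos rfl, mul_one] at h
  exact h

/-- Two cofinite partial isometries that act equally on the diagonal operators modulo compact
operators differ by a diagonal unitary modulo compact operators. -/
theorem exists_eq_mul_phaseOp {u v : H →L[ℂ] H} (hu : IsCofinitePartialIsometry u)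
    (hv : IsCofinitePartialIsometry v)
    (h : ∀ c, calkinMk H (conjBy u (diagOp e c)) = calkinMk H (conjBy v (diagOp e c))) :
    ∃ α : ℕ → Circle, calkinMk H u = calkinMk H v * calkinMk H (phaseOp e α) := by
  have hu' := Unitary.mem_iff.1 hu.calkinMk_mem_unitary
  have hv' := Unitary.mem_iff.1 hv.calkinMk_mem_unitary
  simp only [calkinMk_conjBy] at h
  generalize hU : calkinMk H u = U at *
  generalize hV : calkinMk H v = V at *
  have hT : calkinMk H (star v * u) = star V * U := by
    rw [map_mul, calkinMk_star, hU, hV]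
  -- Equal conjugations of a diagonal `D` by the unitaries `U` and `V` mean that `star V * U`
  -- commutes with `D`.
  obtain ⟨c, hc⟩ := exists_diagOp_sub_compact (e := e) (T := star v * u) fun A => by
    rw [← calkinMk_eq_iff, map_mul (calkinMk H) (star v * u), map_mul (calkinMk H) _ (star v * u), hT,
      coordProj]
    generalize hD : calkinMk H (diagOp e (indicatorFn A)) = D
    have h1 := h (indicatorFn A)
    rw [hD] at h1
    calc star V * U * D = star V * (U * D * star U) * U := by
          simp only [mul_assoc, hu'.1, mul_one]
      _ = star V * V * D * star V * U := by rw [h1]; simp only [mul_assoc]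
      _ = D * (star V * U) := by rw [hv'.1, one_mul, mul_assoc]
  rw [← calkinMk_eq_iff, hT] at hc
  obtain ⟨α, hα⟩ := exists_phaseOp_of_unitary (e := e) (c := c) <| by
    rw [← hc, star_mul, star_star]
    calc star V * U * (star U * V) = star V * (U * star U) * V := by simp only [mul_assoc]
      _ = 1 := by rw [hu'.2, mul_one, hv'.1]
  refine ⟨α, ?_⟩
  rw [← hα, ← hc, ← mul_assoc, hv'.2, one_mul]

/-- Under Todorcevic's Axiom, coherent families of unitaries are uniformized by a single partial
isometry. -/
theorem IsCoherentFamily.exists_uniform (hTA : TodorcevicAxiom)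
    {F : Set (IntervalPartition × (H →L[ℂ] H))} (hF : IsCoherentFamily e F) :
    ∃ w : H →L[ℂ] H, IsCofinitePartialIsometry w ∧
      ∀ p ∈ F, ∀ a ∈ fddAlgebra e p.1, IsCompactOperator (conjBy p.2 a - conjBy w a) := by
  -- Any member can serve as the reference; the partition into singletons is a convenient choice.
  obtain ⟨u₀, hu₀⟩ := hF.total ⟨id, rfl, strictMono_id⟩
  have hu₀' := Unitary.mem_iff.1 (hF.partialIsometry _ hu₀).calkinMk_mem_unitary
  have hphase : ∀ p ∈ F, ∃ α : ℕ → Circle,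
      calkinMk H p.2 = calkinMk H u₀ * calkinMk H (phaseOp e α) := fun p hp =>
    exists_eq_mul_phaseOp (hF.partialIsometry p hp) (hF.partialIsometry _ hu₀) fun c =>
      calkinMk_eq_iff.2 (hF.coherent p hp _ hu₀ _
        ⟨diagOp_mem_fddAlgebra c _, diagOp_mem_fddAlgebra c _⟩)
  have hconj : ∀ (u : H →L[ℂ] H) (α : ℕ → Circle),
      calkinMk H u = calkinMk H u₀ * calkinMk H (phaseOp e α) → ∀ a,
      calkinMk H (conjBy u a) =
        calkinMk H u₀ * calkinMk H (conjBy (phaseOp e α) a) * star (calkinMk H u₀) := by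
    intro u α h a
    rw [calkinMk_conjBy, calkinMk_conjBy, h, star_mul]
    simp only [mul_assoc]
  have hcancel : ∀ x y : Calkin H, calkinMk H u₀ * x * star (calkinMk H u₀) =
      calkinMk H u₀ * y * star (calkinMk H u₀) → x = y := by
    intro x y h
    have h1 : ∀ z : Calkin H, star (calkinMk H u₀) *
        (calkinMk H u₀ * z * star (calkinMk H u₀)) * calkinMk H u₀ = z := fun z => by
      calc _ = (star (calkinMk H u₀) * calkinMk H u₀) * z *
            (star (calkinMk H u₀) * calkinMk H u₀) := by simp only [mul_assoc]
        _ = z := by rw [hu₀'.1, one_mul, mul_one]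
    rw [← h1 x, h, h1 y]
  -- The phases of a member relative to `u₀` are not unique, so all possible choices are collected
  -- in `P`; coherence holds for any of them after cancelling the unitary `u₀`.
  obtain ⟨α, hα⟩ := hTA.exists_uniform_partition (G := Circle)
    (P := {q | ∃ u, (q.1, u) ∈ F ∧ calkinMk H u = calkinMk H u₀ * calkinMk H (phaseOp e q.2)})
    (by
      rintro ⟨E, β⟩ ⟨u, hu, huβ⟩ ⟨E', β'⟩ ⟨u', hu', huβ'⟩
      refine phaseClose_of_calkinMk_conjBy_eq (e := e) fun a ha => hcancel _ _ ?_
      rw [← hconj u β huβ, ← hconj u' β' huβ', calkinMk_eq_iff]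
      exact hF.coherent _ hu _ hu' a ha)
    (fun E => by
      obtain ⟨u, hu⟩ := hF.total E
      obtain ⟨β, hβ⟩ := hphase _ hu
      exact ⟨β, u, hu, hβ⟩)
  refine ⟨u₀ * phaseOp e α, (hF.partialIsometry _ hu₀).mul_phaseOp α, fun p hp a ha => ?_⟩
  obtain ⟨β, hβ⟩ := hphase p hp
  rw [← calkinMk_eq_iff, hconj _ β hβ, hconj _ α (map_mul _ _ _),
    calkinMk_conjBy_phaseOp_eq (hα (p.1, β) ⟨p.2, hp, hβ⟩) ha]

/-- An automorphism that is given by a single cofinite partial isometry on all algebras `D[E]` is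
inner. -/
theorem isInnerAut_of_forall_fddAlgebra {Φ : Calkin H ≃⋆ₐ[ℂ] Calkin H} {w : H →L[ℂ] H}
    (hw : IsCofinitePartialIsometry w)
    (h : ∀ E, ∀ a ∈ fddAlgebra e E, Φ (calkinMk H a) = calkinMk H (conjBy w a)) :
    IsInnerAut Φ := by
  refine ⟨calkinMk H w, hw.calkinMk_mem_unitary, fun x => ?_⟩
  obtain ⟨a, rfl⟩ := Ideal.Quotient.mk_surjective x
  have ha : a ∈ AddSubgroup.closure
      ({a : H →L[ℂ] H | ∃ E, a ∈ fddAlgebra e E} ∪ {a | IsCompactOperator a}) := by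
    rw [closure_fddAlgebra_union_compact]; trivial
  induction ha using AddSubgroup.closure_induction with
  | mem a ha =>
    rcases ha with ⟨E, ha⟩ | ha
    · rw [h E a ha, calkinMk_conjBy]
    · have h0 : calkinMk H a = 0 := Ideal.Quotient.eq_zero_iff_mem.2 ha
      rw [h0, map_zero, mul_zero, zero_mul]
  | zero => simp
  | add a b _ _ ha hb => rw [map_add, map_add, ha, hb, mul_add, add_mul]
  | neg a _ ha => rw [map_neg, map_neg, ha, mul_neg, neg_mul]

end Phases

/-- Under Todorcevic's Axiom, every automorphism of the Calkin algebra determined by a coherent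
family of unitaries is inner, and every coherent family of unitaries is uniformized by a single
partial isometry between subspaces of finite codimension. -/
theorem theoremP1 {H : Type*} [NormedAddCommGroup H] [InnerProductSpace ℂ H] [CompleteSpace H]
    (e : HilbertBasis ℕ ℂ H) (hTA : TodorcevicAxiom) :
    (∀ Φ : Calkin H ≃⋆ₐ[ℂ] Calkin H, (∃ F, IsDeterminedBy e Φ F) → IsInnerAut Φ) ∧
    (∀ F : Set (IntervalPartition × (H →L[ℂ] H)), IsCoherentFamily e F →
      ∃ w : H →L[ℂ] H, IsCofinitePartialIsometry w ∧
        ∀ p ∈ F, ∀ a ∈ fddAlgebra e p.1, IsCompactOperator (conjBy p.2 a - conjBy w a)) := by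
  refine ⟨fun Φ ⟨F, hF, hΦ⟩ => ?_, fun F hF => hF.exists_uniform hTA⟩
  obtain ⟨w, hw, hwF⟩ := hF.exists_uniform hTA
  refine isInnerAut_of_forall_fddAlgebra (e := e) hw fun E a ha => ?_
  obtain ⟨u, hu⟩ := hF.total E
  rw [hΦ _ hu a ha, calkinMk_eq_iff]
  exact hwF _ hu a ha
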